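/- Let $n\ge 3$. A \emph{score sheet} of a round-robin tournament of teams $T_1,\dots,T_n$ is a family $S=(g_{ij})_{1\le i\ne j\le n}$ of nonnegative integers, where $g_{ij}$ is the number of goals that $T_i$ scored against $T_j$; put $g_i=\sum_{j\ne i}g_{ij}$. It is \emph{ordered} if $g_1\ge g_2\ge\dots\ge g_n$, and an ordered score sheet is \emph{runner-up consistent} if the score sheet of $T_2,\dots,T_n$ obtained by deleting the first row and the first column is still ordered, i.e. $\bar g_2\ge\dots\ge\bar g_n$, where $\bar g_i=\sum_{j\ne i,\,j\ne 1}g_{ij}$. Let $\mathscr R_n\subset\mathbb Z^{n(n-1)}$ be the monoid of runner-up consistent ordered score sheets, and let $C_n=\mathbb R_+\mathscr R_n\subset\mathbb R^{n(n-1)}$ be the cone it generates. Let $A_n$ be the set of ordered score sheets for which there is an integer $r$ with $1\le r\le n$ such that each of $T_1,\dots,T_r$ has scored exactly one goal in total, against a team different from $T_1$, and $T_{r+1},\dots,T_n$ have scored no goal. Let $B_n$ be the set of ordered score sheets for which there are integers $r,q$ with $1\le r<q\le n$ such that each of $T_1,\dots,T_r$ has scored exactly one goal in total, against a team different from $T_1$;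 each of $T_{r+1},\dots,T_q$ has scored exactly one goal in total, against $T_1$; and $T_{q+1},\dots,T_n$ have scored no goal. All these score sheets have entries in $\{0,1\}$. Then the following hold. (a) The Hilbert basis $\operatorname{HB}(\mathscr R_n)$, i.e. the set of irreducible elements of $\mathscr R_n$, equals $A_n\cup B_n$, and $A_n\cup B_n$ is the least system of generators of $\mathscr R_n$. (b) $\operatorname{HB}(\mathscr R_n)$ equals the set of extreme integral generators of $C_n$, i.e. the set of integral vectors with coprime components that span the one-dimensional faces of $C_n$. (c) The convex hull of $\operatorname{HB}(\mathscr R_n)$ is the polytope $\mathscr P_n=\{x\in C_n: g_1(x)=1\}$, the set of vertices of $\mathscr P_n$ is $\operatorname{HB}(\mathscr R_n)$, and $\mathscr P_n$ is compressed: for every linear order of its vertices, every maximal simplex of the corresponding pulling triangulation is unimodular, that is, its vertices form an affine basis of the affine lattice $\mathbb Z^{n(n-1)}\cap\operatorname{aff}(\mathscr P_n)$. (The maximal simplices of the pulling triangulation of a polytope $P$ are the joins of the first vertex $v$ of $P$ with the maximal simplices of the pulling triangulations, for the induced orders, of the facets of $P$ that do not contain $v$.) (d) The cardinalities are $$\#A_n=(n-1)\sum_{i=0}^{n-1}(n-2)^i,\qquad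 \#B_n=(n-1)\sum_{i=0}^{n-1}(n-2)^i(n-i-1),$$ $$\#\operatorname{HB}(\mathscr R_n)=\#(A_n\cup B_n)=(n-1)\sum_{i=0}^{n-1}(n-2)^i(n-i)=(n-1)\sum_{k=0}^{n-1}\sum_{i=0}^{k}(n-2)^i.$$ -/

import Mathlib

/-! ### Affine monoids, cones and lattice polytopes in `ℝ^ι` with lattice `ℤ^ι` -/

/-- The inclusion of the lattice `ℤ^ι` in `ℝ^ι`. -/
def latticeEmb {ι : Type*} (z : ι → ℤ) : ι → ℝ := fun i => (z i : ℝ)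

/-- The Hilbert basis of a submonoid of `ℤ^ι`: the set of its irreducible elements. -/
def hilbertBasis {ι : Type*} (M : AddSubmonoid (ι → ℤ)) : Set (ι → ℤ) :=
  {x | ∃ h : x ∈ M, AddIrreducible (⟨x, h⟩ : M)}

/-- The cone `ℝ₊M`: all linear combinations of elements of `M` with nonnegative real
coefficients. -/
def coneOf {ι : Type*} (M : AddSubmonoid (ι → ℤ)) : Set (ι → ℝ) :=
  (PointedCone.hull ℝ (latticeEmb '' (M : Set (ι → ℤ))) : Set (ι → ℝ))

/-- An extreme ray of a pointed cone: a face of dimension `1`. -/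
def IsExtremeRay {ι : Type*} (C F : Set (ι → ℝ)) : Prop :=
  IsExposed ℝ C F ∧ Module.finrank ℝ (Submodule.span ℝ F) = 1

/-- The extreme integral generators of a pointed cone: the vectors with coprime integral
components that span its extreme rays. -/
def extremeIntegralGenerators {ι : Type*} [Fintype ι] (C : Set (ι → ℝ)) : Set (ι → ℤ) :=
  {z | Finset.univ.gcd z = 1 ∧ IsExtremeRay C {x | ∃ t : ℝ, 0 ≤ t ∧ x = t • latticeEmb z}}

/-- A facet of a polytope: a maximal proper face. The empty set counts as a face, so that it is
the only facet of a point. -/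
def IsFacet {ι : Type*} (P F : Set (ι → ℝ)) : Prop :=
  Maximal (fun G => IsExposed ℝ P G ∧ G ≠ P) F

/-- `v` is the first vertex of `P` in the order of the vertices given by `ρ`. -/
def IsFirstVertex {ι : Type*} (ρ : (ι → ℝ) → ℕ) (P : Set (ι → ℝ)) (v : ι → ℝ) : Prop :=
  v ∈ P.extremePoints ℝ ∧ ∀ w ∈ P.extremePoints ℝ, ρ v ≤ ρ w

/-- `IsPullingCell ρ P σ`: `σ` is the vertex set of a maximal simplex of the pulling triangulation
of the polytope `P` with respect to the order of the vertices given by `ρ`. The maximal simplices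
are the joins of the first vertex `v` of `P` with the maximal simplices of the pulling
triangulations (for the same order) of those facets of `P` that do not contain `v`. -/
inductive IsPullingCell {ι : Type*} (ρ : (ι → ℝ) → ℕ) : Set (ι → ℝ) → Set (ι → ℝ) → Prop
  | empty : IsPullingCell ρ ∅ ∅
  | pull {P F σ : Set (ι → ℝ)} {v : ι → ℝ} (hv : IsFirstVertex ρ P v) (hF : IsFacet P F)
      (hvF : v ∉ F) (hσ : IsPullingCell ρ F σ) : IsPullingCell ρ P (insert v σ)

/-- `σ` is the vertex set of a unimodular simplex in the lattice of `P`: it is an affine basis of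
the affine lattice formed by the lattice points of the affine hull of `P`. -/
def IsUnimodularIn {ι : Type*} (P σ : Set (ι → ℝ)) : Prop :=
  AffineIndependent ℝ (fun v : σ => (v : ι → ℝ)) ∧
  (∀ v ∈ σ, v ∈ affineSpan ℝ P ∧ ∃ z : ι → ℤ, v = latticeEmb z) ∧
  ∀ z : ι → ℤ, latticeEmb z ∈ affineSpan ℝ P →
    ∃ c : (ι → ℝ) →₀ ℤ, (c.support : Set (ι → ℝ)) ⊆ σ ∧ (c.sum fun _ a => a) = 1 ∧
      latticeEmb z = c.sum fun v a => (a : ℝ) • v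

/-- A lattice polytope is compressed if for every order of its vertices all maximal simplices of
the pulling triangulation are unimodular. -/
def IsCompressed {ι : Type*} (P : Set (ι → ℝ)) : Prop :=
  (∃ V : Finset (ι → ℤ), P = convexHull ℝ (latticeEmb '' (V : Set (ι → ℤ)))) ∧
  ∀ ρ : (ι → ℝ) → ℕ, Set.InjOn ρ (P.extremePoints ℝ) →
    ∀ σ, IsPullingCell ρ P σ → IsUnimodularIn P σ

/-! ### Score sheets

The teams `T_1, …, T_n` are the elements `0, …, n - 1` of `Fin n`. -/

/-- The positions of a score sheet: pairs of distinct teams. -/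
abbrev Pos (n : ℕ) : Type := {p : Fin n × Fin n // p.1 ≠ p.2}

/-- The set whose only element is the team `T_1`. -/
def firstTeam (n : ℕ) : Finset (Fin n) := Finset.univ.filter fun k => k.val = 0

/-- The set of the teams `T_2, …, T_n`. -/
def otherTeams (n : ℕ) : Finset (Fin n) := Finset.univ.filter fun k => k.val ≠ 0

/-- The number of goals that team `i` scored against the teams of `K`. -/
def goals {R : Type*} [AddCommMonoid R] {n : ℕ} (S : Pos n → R) (K : Finset (Fin n))
    (i : Fin n) : R :=
  ∑ p : Pos n with p.1.1 = i ∧ p.1.2 ∈ K, S p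

/-- The degree `g_1`: the number of goals scored by the team `T_1`. -/
def degOne {R : Type*} [AddCommMonoid R] {n : ℕ} (S : Pos n → R) : R :=
  ∑ i ∈ firstTeam n, goals S Finset.univ i

/-- After the deletion of all rows and columns of teams outside `K`, the teams of `K` are ordered
decreasingly by their number of goals. -/
def OrderedOn {n : ℕ} (S : Pos n → ℤ) (K : Finset (Fin n)) : Prop :=
  ∀ i ∈ K, ∀ j ∈ K, i ≤ j → goals S K j ≤ goals S K i

/-- The monoid of score sheets. -/
def scoreSheets (n : ℕ) : AddSubmonoid (Pos n → ℤ) where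
  carrier := {S | ∀ p, 0 ≤ S p}
  zero_mem' := fun _ => le_rfl
  add_mem' := fun ha hb p => add_nonneg (ha p) (hb p)

theorem goals_add {R : Type*} [AddCommMonoid R] {n : ℕ} (S T : Pos n → R) (K : Finset (Fin n))
    (i : Fin n) : goals (S + T) K i = goals S K i + goals T K i := by
  simp [goals, Finset.sum_add_distrib]

theorem OrderedOn.zero {n : ℕ} (K : Finset (Fin n)) : OrderedOn (0 : Pos n → ℤ) K := by
  intro i _ j _ _
  simp [goals]

theorem OrderedOn.add {n : ℕ} {S T : Pos n → ℤ} {K : Finset (Fin n)} (hS : OrderedOn S K)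
    (hT : OrderedOn T K) : OrderedOn (S + T) K := by
  intro i hi j hj hij
  rw [goals_add, goals_add]
  exact add_le_add (hS i hi j hj hij) (hT i hi j hj hij)

/-- The monoid of ordered score sheets: `g_1 ≥ g_2 ≥ ⋯ ≥ g_n`. -/
def orderedScoreSheets (n : ℕ) : AddSubmonoid (Pos n → ℤ) where
  carrier := {S | S ∈ scoreSheets n ∧ OrderedOn S Finset.univ}
  zero_mem' := ⟨zero_mem _, OrderedOn.zero _⟩
  add_mem' := fun ha hb => ⟨add_mem ha.1 hb.1, ha.2.add hb.2⟩

/-- The monoid of runner-up consistent ordered score sheets: the remaining teams are still ordered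
after the deletion of the first row and the first column. -/
def runnerUpConsistent (n : ℕ) : AddSubmonoid (Pos n → ℤ) where
  carrier := {S | S ∈ orderedScoreSheets n ∧ OrderedOn S (otherTeams n)}
  zero_mem' := ⟨zero_mem _, OrderedOn.zero _⟩
  add_mem' := fun ha hb => ⟨add_mem ha.1 hb.1, ha.2.add hb.2⟩

/-- Team `i` scored exactly one goal, against a team different from `T_1`. -/
def ScoresOnceAgainstOthers {n : ℕ} (S : Pos n → ℤ) (i : Fin n) : Prop :=
  goals S (otherTeams n) i = 1 ∧ goals S (firstTeam n) i = 0

/-- Team `i` scored exactly one goal, against `T_1`. -/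
def ScoresOnceAgainstFirst {n : ℕ} (S : Pos n → ℤ) (i : Fin n) : Prop :=
  goals S (firstTeam n) i = 1 ∧ goals S (otherTeams n) i = 0

/-- Team `i` scored no goal. -/
def ScoresNothing {n : ℕ} (S : Pos n → ℤ) (i : Fin n) : Prop :=
  goals S Finset.univ i = 0

/-- The set `A_n`. -/
def setA (n : ℕ) : Set (Pos n → ℤ) :=
  {S | S ∈ orderedScoreSheets n ∧ ∃ r : ℕ, 1 ≤ r ∧ r ≤ n ∧ ∀ i : Fin n,
    (i.val < r → ScoresOnceAgainstOthers S i) ∧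
    (r ≤ i.val → ScoresNothing S i)}

/-- The set `B_n`. -/
def setB (n : ℕ) : Set (Pos n → ℤ) :=
  {S | S ∈ orderedScoreSheets n ∧ ∃ r q : ℕ, 1 ≤ r ∧ r < q ∧ q ≤ n ∧ ∀ i : Fin n,
    (i.val < r → ScoresOnceAgainstOthers S i) ∧
    (r ≤ i.val → i.val < q → ScoresOnceAgainstFirst S i) ∧
    (q ≤ i.val → ScoresNothing S i)}

/-!
The runner-up consistent ordered score sheets are the lattice points of a cone given by integral
inequalities `slack c x ≥ 0`: nonnegativity of the entries, `g_i ≥ g_j` and `ḡ_i ≥ ḡ_j` for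
`i ≤ j`. As `T_1` does not play against itself, `ḡ_1 = g_1` extends the second chain, so that a
point of the cone amounts to two decreasing sequences `ḡ ≤ g` with the same first entry, together
with a distribution of the `ḡ_i` over the admissible opponents. If `r` and `q` are the numbers of
positive terms of `ḡ` and `g`, one can choose for each team a positive entry in its row; this gives
a score sheet in `A_n` (if `r = q`) or `B_n` (if `r < q`) that satisfies with equality all
inequalities tight at the given point (`exists_isPattern`). Such a score sheet is encoded by the
function `f` that sends a team to its only opponent conceding a goal, or to itself if there is none.

Two properties of these score sheets do the rest. All forms `slack c` have values `0` or `1` on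
them (`IsPattern.slack_eq`), and the inequalities tight at one of them determine it up to a factor
(`IsPattern.eq_smul_of_slack_eq_zero`). By the first property, subtracting the score sheet found
above leaves an integral point in the cone, so that every element of the monoid is a sum of score
sheets in `A_n ∪ B_n`. Over the reals one subtracts the largest possible multiple, and induction on
the number of strict inequalities shows that these score sheets span the cone. By the second
property they span extreme rays and are the vertices of the polytope.

That the polytope is compressed holds for all lattice polytopes on whose vertices the defining
integral inequalities have slack `0` or `1` (`IsPullingCell.isUnimodularIn_faceOf`): the first
vertex of a face has lattice distance `1` from each facet of the face that does not contain it, so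
that the join with a unimodular simplex in the facet is again unimodular.

The sets `A_n` and `B_n` are counted by the functions `f`: the first team has `n - 1` choices, each
of the teams `T_2, …, T_r` has `n - 2`, and the other teams have one.
-/

/-! ### Polytopes of facet width one are compressed -/

section FacetWidthOne

variable {ι I : Type*}

/-- The face of the polytope `{x | d x = 1, ℓ i x ≥ 0 for all i}` cut out by the equations
`ℓ j x = 0`, `j ∈ J`. -/
def faceOf (d : (ι → ℝ) →ₗ[ℝ] ℝ) (ℓ : I → (ι → ℝ) →ₗ[ℝ] ℝ) (J : Set I) : Set (ι → ℝ) :=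
  {x | d x = 1 ∧ (∀ i, 0 ≤ ℓ i x) ∧ ∀ j ∈ J, ℓ j x = 0}

variable {d : (ι → ℝ) →ₗ[ℝ] ℝ} {ℓ : I → (ι → ℝ) →ₗ[ℝ] ℝ} {J : Set I}

theorem mem_faceOf_insert {i : I} {x : ι → ℝ} :
    x ∈ faceOf d ℓ (insert i J) ↔ x ∈ faceOf d ℓ J ∧ ℓ i x = 0 := by
  simp only [faceOf, Set.mem_ofPred_eq, Set.forall_mem_insert]
  tauto

theorem faceOf_subset : faceOf d ℓ J ⊆ faceOf d ℓ ∅ :=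
  fun _ hx => ⟨hx.1, hx.2.1, fun _ h => h.elim⟩

theorem convex_faceOf : Convex ℝ (faceOf d ℓ J) := by
  intro x hx y hy a b ha hb hab
  refine ⟨?_, fun i => ?_, fun j hj => ?_⟩
  · simp [hx.1, hy.1, hab]
  · have h1 := hx.2.1 i
    have h2 := hy.2.1 i
    simp only [map_add, map_smul, smul_eq_mul]
    positivity
  · simp [hx.2.2 j hj, hy.2.2 j hj]

theorem isExtreme_faceOf : IsExtreme ℝ (faceOf d ℓ ∅) (faceOf d ℓ J) := by
  refine ⟨faceOf_subset, ?_⟩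
  rintro x hx y hy z hz ⟨a, b, ha, hb, hab, rfl⟩
  refine ⟨hx.1, hx.2.1, fun j hj => ?_⟩
  have h := hz.2.2 j hj
  have h1 := hx.2.1 j
  have h2 := mul_nonneg hb.le (hy.2.1 j)
  simp only [map_add, map_smul, smul_eq_mul] at h
  have h3 : a * ℓ j x = 0 := by nlinarith [mul_nonneg ha.le h1]
  exact (mul_eq_zero.1 h3).resolve_left ha.ne'

theorem isExposed_faceOf_insert [Fintype ι] (i : I) :
    IsExposed ℝ (faceOf d ℓ J) (faceOf d ℓ (insert i J)) := by
  rintro ⟨w, hw⟩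
  refine ⟨-(LinearMap.toContinuousLinearMap (ℓ i)), ?_⟩
  rw [mem_faceOf_insert] at hw
  ext x
  simp only [mem_faceOf_insert, Set.mem_ofPred_eq, neg_apply,
    LinearMap.coe_toContinuousLinearMap', neg_le_neg_iff]
  refine and_congr_right fun hx => ⟨fun h y hy => h ▸ hy.2.1 i, fun h => ?_⟩
  exact le_antisymm (hw.2 ▸ h w hw.1) (hx.2.1 i)

/-- A nonempty convex set on which finitely many linear forms are nonnegative contains a point at
which all of them that do not vanish identically on the set are positive. -/
theorem exists_forall_pos_of_convex [Finite I] {F : Set (ι → ℝ)} (hF : Convex ℝ F)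
    (hne : F.Nonempty) (hpos : ∀ i, ∀ x ∈ F, 0 ≤ ℓ i x) :
    ∃ x ∈ F, ∀ i, ℓ i x = 0 → ∀ y ∈ F, ℓ i y = 0 := by
  classical
  cases nonempty_fintype I
  suffices h : ∀ s : Finset I, ∃ x ∈ F, ∀ i ∈ s, ℓ i x = 0 → ∀ y ∈ F, ℓ i y = 0 by
    obtain ⟨x, hx, h⟩ := h Finset.univ
    exact ⟨x, hx, fun i => h i (Finset.mem_univ i)⟩
  intro s
  induction s using Finset.induction_on with
  | empty =>
    obtain ⟨x, hx⟩ := hne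
    exact ⟨x, hx, by simp⟩
  | insert i s _ ih =>
    obtain ⟨x, hx, h⟩ := ih
    by_cases hi : ∀ y ∈ F, ℓ i y = 0
    · exact ⟨x, hx, fun j hj hjx => (Finset.mem_insert.1 hj).elim (fun e => e ▸ hi)
        fun hj => h j hj hjx⟩
    push Not at hi
    obtain ⟨y, hy, hyi⟩ := hi
    refine ⟨(1 / 2 : ℝ) • x + (1 / 2 : ℝ) • y, hF hx hy (by norm_num) (by norm_num) (by norm_num),
      fun j hj hjx => ?_⟩
    have h1 := hpos j x hx
    have h2 := hpos j y hy
    simp only [map_add, map_smul, smul_eq_mul] at hjx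
    rcases Finset.mem_insert.1 hj with rfl | hj
    · exact absurd (by linarith) hyi
    · exact h j hj (by linarith)

/-- From a point `x` satisfying finitely many inequalities `ℓ i x ≥ 0` one can move a little in
every direction along which the tight inequalities stay tight. -/
theorem exists_pos_forall_nonneg_add_smul [Finite I] {x u : ι → ℝ} (hx : ∀ i, 0 ≤ ℓ i x)
    (hu : ∀ i, ℓ i x = 0 → ℓ i u = 0) : ∃ ε : ℝ, 0 < ε ∧ ∀ i, 0 ≤ ℓ i (x + ε • u) := by
  have h : ∀ᶠ ε : ℝ in nhdsWithin 0 (Set.Ioi 0), ∀ i, 0 ≤ ℓ i (x + ε • u) := by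
    rw [Filter.eventually_all]
    intro i
    rcases (hx i).eq_or_lt with h | h
    · exact Filter.Eventually.of_forall fun ε => by simp [← h, hu i h.symm]
    · have hc : Continuous fun ε : ℝ => ℓ i x + ε * ℓ i u := by fun_prop
      have := (hc.tendsto 0).eventually (lt_mem_nhds (a := 0) (by simpa using h))
      filter_upwards [this.filter_mono nhdsWithin_le_nhds] with ε hε
      simpa using hε.le
  obtain ⟨ε, hε, h0⟩ := (h.and self_mem_nhdsWithin).exists
  exact ⟨ε, h0, hε⟩

variable [Fintype ι]

theorem isCompact_faceOf (hP : IsCompact (faceOf d ℓ ∅)) : IsCompact (faceOf d ℓ J) := by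
  refine hP.of_isClosed_subset ?_ faceOf_subset
  have h (f : (ι → ℝ) →ₗ[ℝ] ℝ) : Continuous f := f.continuous_of_finiteDimensional
  simp only [faceOf, Set.ofPred_and, Set.ofPred_forall]
  exact (isClosed_eq (h d) continuous_const).inter
    ((isClosed_iInter fun i => isClosed_le continuous_const (h _)).inter
      (isClosed_iInter fun i => isClosed_iInter fun _ => isClosed_eq (h _) continuous_const))

/-- Linear forms that agree on the vertices of a compact face agree on its affine hull. -/
theorem eq_of_mem_affineSpan_faceOf (hP : IsCompact (faceOf d ℓ ∅)) {f g : (ι → ℝ) →ₗ[ℝ] ℝ}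
    (hfg : ∀ w ∈ (faceOf d ℓ J).extremePoints ℝ, f w = g w) {y : ι → ℝ}
    (hy : y ∈ affineSpan ℝ (faceOf d ℓ J)) : f y = g y := by
  have h (f : (ι → ℝ) →ₗ[ℝ] ℝ) : Continuous f := f.continuous_of_finiteDimensional
  have hsub : faceOf d ℓ J ⊆ {x | f x = g x} := by
    rw [← closure_convexHull_extremePoints (isCompact_faceOf hP) convex_faceOf]
    refine closure_minimal (convexHull_min hfg ?_) (isClosed_eq (h f) (h g))
    intro x hx y hy a b _ _ _
    simp only [Set.mem_ofPred_eq, map_add, map_smul] at *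
    rw [hx, hy]
  refine affineSpan_induction hy hsub ?_
  intro c u v w hu hv hw
  simp only [vsub_eq_sub, vadd_eq_add, map_add, map_sub, map_smul, hu, hv, hw]

/-- If the only facet of a face is empty, then the face is a point. -/
theorem eq_singleton_of_isFacet_empty (hP : IsCompact (faceOf d ℓ ∅))
    (hinj : ∀ x, (∀ i, ℓ i x = 0) → x = 0)
    (h01 : ∀ w ∈ (faceOf d ℓ ∅).extremePoints ℝ, ∀ i, ℓ i w = 0 ∨ ℓ i w = 1)
    (hF : IsFacet (faceOf d ℓ J) ∅) {v : ι → ℝ} (hv : v ∈ (faceOf d ℓ J).extremePoints ℝ) :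
    faceOf d ℓ J = {v} := by
  have hnot {i : I} {a b : ι → ℝ} (ha : a ∈ faceOf d ℓ J) (hb : b ∈ faceOf d ℓ J)
      (ha0 : ℓ i a = 0) (hb1 : ℓ i b = 1) : False := by
    have := hF.2 (y := faceOf d ℓ (insert i J)) ⟨isExposed_faceOf_insert i, fun e => ?_⟩
      (Set.empty_subset _)
    · exact this (mem_faceOf_insert.2 ⟨ha, ha0⟩)
    · have := (mem_faceOf_insert.1 (e.symm ▸ hb : b ∈ faceOf d ℓ (insert i J))).2
      rw [this] at hb1
      exact zero_ne_one hb1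
  have hext : (faceOf d ℓ J).extremePoints ℝ = {v} := by
    refine Set.eq_singleton_iff_unique_mem.2 ⟨hv, fun w hw => ?_⟩
    refine sub_eq_zero.1 (hinj _ fun i => ?_)
    rw [map_sub]
    have h1 := h01 w (isExtreme_faceOf.extremePoints_subset_extremePoints hw) i
    have h2 := h01 v (isExtreme_faceOf.extremePoints_subset_extremePoints hv) i
    rcases h1 with h1 | h1 <;> rcases h2 with h2 | h2
    · rw [h1, h2, sub_zero]
    · exact (hnot hw.1 hv.1 h1 h2).elim
    · exact (hnot hv.1 hw.1 h2 h1).elim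
    · rw [h1, h2, sub_self]
  rw [← closure_convexHull_extremePoints (isCompact_faceOf hP) convex_faceOf, hext,
    convexHull_singleton, closure_singleton]

variable [Finite I]

/-- A facet of `faceOf d ℓ J` that does not contain the point `v` is cut out by a single one of the
forms `ℓ i`, which does not vanish at `v`. -/
theorem exists_eq_faceOf_insert {F : Set (ι → ℝ)} (hF : IsFacet (faceOf d ℓ J) F)
    (hne : F.Nonempty) {v : ι → ℝ} (hv : v ∈ faceOf d ℓ J) (hvF : v ∉ F) :
    ∃ i, F = faceOf d ℓ (insert i J) ∧ ℓ i v ≠ 0 := by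
  obtain ⟨⟨hexp, _⟩, hmax⟩ := hF
  have hFP := hexp.subset
  -- If all forms that vanish on `F` vanished at `v`, then a point in the relative interior of `F`
  -- would be an inner point of a segment in the polytope with endpoint `v`.
  have key : ∃ i, (∀ y ∈ F, ℓ i y = 0) ∧ ℓ i v ≠ 0 := by
    by_contra! hcon
    obtain ⟨x, hx, h⟩ := exists_forall_pos_of_convex (ℓ := ℓ) (hexp.convex convex_faceOf) hne
      fun i x hx => (hFP hx).2.1 i
    obtain ⟨ε, hε, h1⟩ := exists_pos_forall_nonneg_add_smul (ℓ := ℓ) (x := x) (u := x - v)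
      (hFP hx).2.1 fun i hi => by rw [map_sub, hi, hcon i (h i hi), sub_zero]
    have hw : x + ε • (x - v) ∈ faceOf d ℓ J := by
      refine ⟨?_, h1, fun j hj => ?_⟩
      · simp [(hFP hx).1, hv.1]
      · simp [(hFP hx).2.2 j hj, hv.2.2 j hj]
    refine hvF (hexp.isExtreme.left_mem_of_mem_openSegment hv hw hx ?_)
    refine ⟨ε / (1 + ε), 1 / (1 + ε), by positivity, by positivity, by field_simp; ring, ?_⟩
    ext k
    simp only [Pi.add_apply, Pi.smul_apply, Pi.sub_apply, smul_eq_mul]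
    field_simp
    ring
  obtain ⟨i, hi, hiv⟩ := key
  have hsub : F ⊆ faceOf d ℓ (insert i J) := fun y hy => mem_faceOf_insert.2 ⟨hFP hy, hi y hy⟩
  refine ⟨i, hsub.antisymm (hmax ⟨isExposed_faceOf_insert i, fun h => ?_⟩ hsub), hiv⟩
  exact hiv (mem_faceOf_insert.1 (h ▸ hv)).2

/-- If all forms `ℓ i` take only the values `0` and `1` at the vertices, then the affine hull of a
facet `ℓ i = 0` is the intersection of the affine hull of the polytope with this hyperplane. The
reason is that any other form vanishing on the facet vanishes on the whole polytope or agrees with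
`ℓ i` at all vertices. -/
theorem mem_affineSpan_faceOf_insert (hP : IsCompact (faceOf d ℓ ∅))
    (h01 : ∀ w ∈ (faceOf d ℓ ∅).extremePoints ℝ, ∀ i, ℓ i w = 0 ∨ ℓ i w = 1) {i : I}
    (hF : IsFacet (faceOf d ℓ J) (faceOf d ℓ (insert i J)))
    (hne : (faceOf d ℓ (insert i J)).Nonempty) {y : ι → ℝ}
    (hy : y ∈ affineSpan ℝ (faceOf d ℓ J)) (hiy : ℓ i y = 0) :
    y ∈ affineSpan ℝ (faceOf d ℓ (insert i J)) := by
  obtain ⟨x, hx, h⟩ := exists_forall_pos_of_convex (ℓ := ℓ)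
    (convex_faceOf (d := d) (J := insert i J)) hne fun i x hx => hx.2.1 i
  have hxP := (mem_faceOf_insert.1 hx).1
  have hvan (k : I) (hk : ∀ z ∈ faceOf d ℓ J, ℓ k z = 0) : ℓ k y = 0 :=
    eq_of_mem_affineSpan_faceOf hP (g := 0) (fun w hw => hk w hw.1) hy
  -- The form `ℓ k` with `ℓ k x = 0` vanishes on the facet, so it cuts out the facet unless it
  -- vanishes on the whole face.
  have hzero (k : I) (hk : ℓ k x = 0) : ℓ k y = 0 := by
    by_cases hkP : ∀ z ∈ faceOf d ℓ J, ℓ k z = 0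
    · exact hvan k hkP
    have hik : faceOf d ℓ (insert i J) ⊆ faceOf d ℓ (insert k J) := fun z hz =>
      mem_faceOf_insert.2 ⟨(mem_faceOf_insert.1 hz).1, h k hk z hz⟩
    have hki : faceOf d ℓ (insert k J) ⊆ faceOf d ℓ (insert i J) :=
      hF.2 ⟨isExposed_faceOf_insert k, fun e => hkP fun z hz =>
        (mem_faceOf_insert.1 (e.symm ▸ hz : z ∈ faceOf d ℓ (insert k J))).2⟩ hik
    rw [← hiy]
    refine eq_of_mem_affineSpan_faceOf hP (fun w hw => ?_) hy
    have hw0 := isExtreme_faceOf.extremePoints_subset_extremePoints hw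
    have e1 : ℓ k w = 0 → ℓ i w = 0 := fun e =>
      (mem_faceOf_insert.1 (hki (mem_faceOf_insert.2 ⟨hw.1, e⟩))).2
    have e2 : ℓ i w = 0 → ℓ k w = 0 := fun e =>
      (mem_faceOf_insert.1 (hik (mem_faceOf_insert.2 ⟨hw.1, e⟩))).2
    rcases h01 w hw0 k with hk' | hk' <;> rcases h01 w hw0 i with hi' | hi'
    · rw [hk', hi']
    · rw [hk', e1 hk']
    · rw [hi', e2 hi']
    · rw [hk', hi']
  have hdy : d y = 1 := by
    refine affineSpan_induction (p := fun y => d y = 1) hy (fun z hz => hz.1) ?_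
    intro c u v w hu hv hw
    simp [hu, hv, hw]
  obtain ⟨ε, hε, h1⟩ := exists_pos_forall_nonneg_add_smul (ℓ := ℓ) (x := x) (u := y - x)
    hx.2.1 fun k hk => by rw [map_sub, hk, hzero k hk, sub_zero]
  have hw : x + ε • (y - x) ∈ faceOf d ℓ (insert i J) := by
    refine ⟨by simp [hx.1, hdy], h1, fun j hj => ?_⟩
    simp [hx.2.2 j hj, hzero j (hx.2.2 j hj)]
  have hm := AffineMap.lineMap_mem (k := ℝ) ε⁻¹ (subset_affineSpan ℝ _ hx)
    (subset_affineSpan ℝ _ hw)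
  rwa [AffineMap.lineMap_apply, vsub_eq_sub, add_sub_cancel_left, smul_smul,
    inv_mul_cancel₀ hε.ne', one_smul, vadd_eq_add, sub_add_cancel] at hm

theorem isUnimodularIn_singleton {ι : Type*} (z : ι → ℤ) :
    IsUnimodularIn {latticeEmb z} {latticeEmb z} := by
  refine ⟨affineIndependent_of_subsingleton _ _, ?_, fun y hy => ?_⟩
  · rintro _ rfl
    exact ⟨mem_affineSpan ℝ rfl, z, rfl⟩
  · rw [AffineSubspace.mem_affineSpan_singleton] at hy
    refine ⟨Finsupp.single (latticeEmb z) 1, ?_, ?_, ?_⟩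
    · intro x hx
      exact Finset.mem_singleton.1 (Finsupp.support_single_subset hx)
    · simp
    · simp [hy]

/-- Let `ℓ` be an integral linear form that vanishes on `F ⊆ P` and has value `1` at `v`. A
unimodular simplex of `F` and `v` span a unimodular simplex of `P`, provided that the affine hull
of `F` is the hyperplane section `ℓ = 0` of the affine hull of `P`. -/
theorem IsUnimodularIn.insert_vertex {ι : Type*} {P F σ : Set (ι → ℝ)} (hσ : IsUnimodularIn F σ)
    (hFP : F ⊆ P) (hne : σ.Nonempty) (f : (ι → ℝ) →ₗ[ℝ] ℝ)
    (hf : ∀ z : ι → ℤ, ∃ k : ℤ, f (latticeEmb z) = k) (hfF : ∀ x ∈ F, f x = 0)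
    (hspan : ∀ y ∈ affineSpan ℝ P, f y = 0 → y ∈ affineSpan ℝ F) {v : ι → ℤ}
    (hvP : latticeEmb v ∈ P) (hfv : f (latticeEmb v) = 1) :
    IsUnimodularIn P (insert (latticeEmb v) σ) := by
  classical
  obtain ⟨hind, hlat, hgen⟩ := hσ
  have hf0 {y : ι → ℝ} (hy : y ∈ affineSpan ℝ F) : f y = 0 := by
    refine affineSpan_induction (p := fun y => f y = 0) hy hfF ?_
    intro c a b e ha hb he
    simp [ha, hb, he]
  have hvσ : latticeEmb v ∉ σ := fun h => by
    have := hf0 (hlat _ h).1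
    rw [hfv] at this
    exact one_ne_zero this
  refine ⟨?_, ?_, fun z hz => ?_⟩
  · refine AffineIndependent.affineIndependent_of_notMem_span
      (i := (⟨latticeEmb v, Set.mem_insert _ _⟩ : ↥(insert (latticeEmb v) σ))) ?_ ?_
    · have hmem (x : {y : ↥(insert (latticeEmb v) σ) // y ≠ ⟨latticeEmb v, Set.mem_insert _ _⟩}) :
          (x.1 : ι → ℝ) ∈ σ :=
        x.1.2.resolve_left fun h => x.2 (Subtype.ext h)
      exact hind.comp_embedding ⟨fun x => ⟨x.1.1, hmem x⟩, fun x y h =>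
        Subtype.ext (Subtype.ext (Subtype.mk.inj h))⟩
    · intro h
      have hle : affineSpan ℝ ((fun x : ↥(insert (latticeEmb v) σ) => (x : ι → ℝ)) ''
          {x | x ≠ ⟨latticeEmb v, Set.mem_insert _ _⟩}) ≤ affineSpan ℝ F := by
        refine affineSpan_le.2 ?_
        rintro _ ⟨x, hx, rfl⟩
        exact (hlat _ (x.2.resolve_left fun h => hx (Subtype.ext h))).1
      have := hf0 (hle h)
      rw [hfv] at this
      exact one_ne_zero this
  · rintro w (rfl | hw)
    · exact ⟨subset_affineSpan ℝ _ hvP, v, rfl⟩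
    · exact ⟨affineSpan_mono ℝ hFP (hlat w hw).1, (hlat w hw).2⟩
  · -- Moving `z` by a multiple of the edge from a vertex `w` of `σ` to `v` leads into `ℓ = 0`.
    obtain ⟨w, hw⟩ := hne
    obtain ⟨hwF, u, rfl⟩ := hlat w hw
    obtain ⟨k, hk⟩ := hf z
    have hy : latticeEmb (z - k • (v - u)) =
        (-(k : ℝ)) • (latticeEmb v - latticeEmb u) + latticeEmb z := by
      ext i
      simp [latticeEmb]
      ring
    have hyP : latticeEmb (z - k • (v - u)) ∈ affineSpan ℝ P := by
      rw [hy]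
      exact (affineSpan ℝ P).smul_vsub_vadd_mem _ (subset_affineSpan ℝ _ hvP)
        (affineSpan_mono ℝ hFP hwF) hz
    obtain ⟨c, hc, hc1, hcs⟩ := hgen _ (hspan _ hyP (by rw [hy]; simp [hfv, hf0 hwF, hk]))
    refine ⟨c + Finsupp.single (latticeEmb v) k + Finsupp.single (latticeEmb u) (-k), ?_, ?_, ?_⟩
    · intro x hx
      by_contra hxn
      rw [Set.mem_insert_iff, not_or] at hxn
      have h1 : c x = 0 := by
        by_contra h
        exact hxn.2 (hc (Finsupp.mem_support_iff.2 h))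
      have h2 : latticeEmb u ≠ x := fun e => hxn.2 (e ▸ hw)
      have h3 : latticeEmb v ≠ x := fun e => hxn.1 e.symm
      simp [h1, Finsupp.single_eq_of_ne' h2, Finsupp.single_eq_of_ne' h3] at hx
    · rw [Finsupp.sum_add_index' (by simp) (by simp), Finsupp.sum_add_index' (by simp) (by simp),
        Finsupp.sum_single_index (by simp), Finsupp.sum_single_index (by simp), hc1]
      ring
    · rw [Finsupp.sum_add_index' (by simp) (by simp [add_smul]),
        Finsupp.sum_add_index' (by simp) (by simp [add_smul]),
        Finsupp.sum_single_index (by simp), Finsupp.sum_single_index (by simp), ← hcs, hy]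
      push_cast
      module

theorem IsPullingCell.nonempty {ι : Type*} {ρ : (ι → ℝ) → ℕ} {P σ : Set (ι → ℝ)}
    (h : IsPullingCell ρ P σ) (hP : P.Nonempty) : σ.Nonempty := by
  cases h with
  | empty => exact hP
  | pull => exact Set.insert_nonempty _ _

/-- Let `P` be a lattice polytope of the form `{x | d x = 1, ℓ i x ≥ 0 for all i}` with integral
forms `ℓ i` that take only the values `0` and `1` at the vertices. Then all cells of the pulling
triangulations of the faces of `P` are unimodular. -/
theorem IsPullingCell.isUnimodularIn_faceOf (hP : IsCompact (faceOf d ℓ ∅))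
    (hinj : ∀ x, (∀ i, ℓ i x = 0) → x = 0)
    (hℓ : ∀ i, ∀ z : ι → ℤ, ∃ k : ℤ, ℓ i (latticeEmb z) = k)
    (hvert : ∀ w ∈ (faceOf d ℓ ∅).extremePoints ℝ,
      (∃ z, w = latticeEmb z) ∧ ∀ i, ℓ i w = 0 ∨ ℓ i w = 1)
    {ρ : (ι → ℝ) → ℕ} {Q σ : Set (ι → ℝ)} (h : IsPullingCell ρ Q σ) :
    ∀ J : Set I, Q = faceOf d ℓ J → IsUnimodularIn Q σ := by
  induction h with
  | empty =>
    intro J _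
    refine ⟨affineIndependent_of_subsingleton _ _, by simp, fun z hz => ?_⟩
    rw [AffineSubspace.span_empty] at hz
    exact hz.elim
  | @pull Q F σ v hv hF hvF hσ ih =>
    rintro J rfl
    have h01 := fun w hw => (hvert w hw).2
    obtain ⟨⟨z, rfl⟩, hv01⟩ := hvert v (isExtreme_faceOf.extremePoints_subset_extremePoints hv.1)
    rcases F.eq_empty_or_nonempty with rfl | hne
    · rw [eq_singleton_of_isFacet_empty hP hinj h01 hF hv.1]
      cases hσ with
      | empty =>
        rw [insert_empty_eq]
        exact isUnimodularIn_singleton z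
      | pull hv' => exact hv'.1.1.elim
    · obtain ⟨i, rfl, hiv⟩ := exists_eq_faceOf_insert hF hne hv.1.1 hvF
      exact (ih _ rfl).insert_vertex hF.1.1.subset (hσ.nonempty hne) (ℓ i) (hℓ i)
        (fun x hx => (mem_faceOf_insert.1 hx).2)
        (fun y hy hy0 => mem_affineSpan_faceOf_insert hP h01 hF hne hy hy0) hv.1.1
        ((hv01 i).resolve_left hiv)

end FacetWidthOne

/-! ### The inequalities of the cone of runner-up consistent score sheets -/

section Slack

variable {n : ℕ}

/-- The positions of the entries and the pairs of teams that have to be compared, among all teams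
and among all teams but `T_1`: they index the inequalities that define the runner-up consistent
ordered score sheets. -/
abbrev Inequality (n : ℕ) : Type :=
  Pos n ⊕ {p : Fin n × Fin n // p.1 ≤ p.2} ⊕
    {p : Fin n × Fin n // p.1 ∈ otherTeams n ∧ p.2 ∈ otherTeams n ∧ p.1 ≤ p.2}

/-- The number of goals of a team against the teams of `K` as a linear form. -/
def goalsLin (R : Type*) [CommRing R] (K : Finset (Fin n)) (i : Fin n) : (Pos n → R) →ₗ[R] R where
  toFun S := goals S K i
  map_add' S T := goals_add S T K i
  map_smul' c S := by simp [goals, Finset.mul_sum]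

/-- The linear form that is nonnegative on the solutions of a given inequality. -/
def slack (R : Type*) [CommRing R] : Inequality n → (Pos n → R) →ₗ[R] R
  | .inl p => LinearMap.proj p
  | .inr (.inl p) => goalsLin R Finset.univ p.1.1 - goalsLin R Finset.univ p.1.2
  | .inr (.inr p) => goalsLin R (otherTeams n) p.1.1 - goalsLin R (otherTeams n) p.1.2

section Apply

variable {R : Type*} [CommRing R]

@[simp] theorem slack_inl (p : Pos n) (S : Pos n → R) : slack R (.inl p) S = S p := rfl

@[simp] theorem slack_inr_inl (p : {p : Fin n × Fin n // p.1 ≤ p.2}) (S : Pos n → R) :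
    slack R (.inr (.inl p)) S = goals S Finset.univ p.1.1 - goals S Finset.univ p.1.2 := rfl

@[simp] theorem slack_inr_inr
    (p : {p : Fin n × Fin n // p.1 ∈ otherTeams n ∧ p.2 ∈ otherTeams n ∧ p.1 ≤ p.2})
    (S : Pos n → R) :
    slack R (.inr (.inr p)) S = goals S (otherTeams n) p.1.1 - goals S (otherTeams n) p.1.2 := rfl

end Apply

theorem mem_runnerUpConsistent {S : Pos n → ℤ} :
    S ∈ runnerUpConsistent n ↔ ∀ c, 0 ≤ slack ℤ c S := by
  refine ⟨fun ⟨⟨h1, h2⟩, h3⟩ => ?_, fun h => ⟨⟨fun p => h (.inl p), fun i _ j _ hij => ?_⟩,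
    fun i hi j hj hij => ?_⟩⟩
  · rintro (p | ⟨p, hp⟩ | ⟨p, hp⟩)
    · exact h1 p
    · exact sub_nonneg.2 (h2 _ (Finset.mem_univ _) _ (Finset.mem_univ _) hp)
    · exact sub_nonneg.2 (h3 _ hp.1 _ hp.2.1 hp.2.2)
  · exact sub_nonneg.1 (h (.inr (.inl ⟨(i, j), hij⟩)))
  · exact sub_nonneg.1 (h (.inr (.inr ⟨(i, j), hi, hj, hij⟩)))

theorem goals_latticeEmb (S : Pos n → ℤ) (K : Finset (Fin n)) (i : Fin n) :
    goals (latticeEmb S) K i = ((goals S K i : ℤ) : ℝ) := by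
  simp [goals, latticeEmb]

theorem slack_latticeEmb (c : Inequality n) (S : Pos n → ℤ) :
    slack ℝ c (latticeEmb S) = (slack ℤ c S : ℝ) := by
  rcases c with p | p | p
  · simp [latticeEmb]
  · simp [goals_latticeEmb]
  · simp [goals_latticeEmb]

theorem degOne_latticeEmb (S : Pos n → ℤ) : degOne (latticeEmb S) = ((degOne S : ℤ) : ℝ) := by
  simp [degOne, goals_latticeEmb]

theorem latticeEmb_injective {ι : Type*} :
    Function.Injective (latticeEmb : (ι → ℤ) → ι → ℝ) := by
  intro a b h
  funext i
  exact Int.cast_injective (congrFun h i : (a i : ℝ) = b i)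

theorem latticeEmb_add {ι : Type*} (a b : ι → ℤ) :
    latticeEmb (a + b) = latticeEmb a + latticeEmb b := by
  ext i
  simp [latticeEmb]

theorem firstTeam_eq (hn : 0 < n) : firstTeam n = {⟨0, hn⟩} := by
  ext k
  simp [firstTeam, Fin.ext_iff]

/-- The degree `g_1` as a linear form. -/
def degOneLin (n : ℕ) (R : Type*) [CommRing R] : (Pos n → R) →ₗ[R] R :=
  ∑ i ∈ firstTeam n, goalsLin R Finset.univ i

@[simp] theorem degOneLin_apply {R : Type*} [CommRing R] (S : Pos n → R) :
    degOneLin n R S = degOne S := by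
  simp [degOneLin, degOne, goalsLin]

theorem degOne_eq {R : Type*} [AddCommMonoid R] (hn : 0 < n) (S : Pos n → R) :
    degOne S = goals S Finset.univ ⟨0, hn⟩ := by
  simp [degOne, firstTeam_eq hn]

theorem goals_univ_eq {R : Type*} [AddCommMonoid R] (S : Pos n → R) (i : Fin n) :
    goals S Finset.univ i = goals S (firstTeam n) i + goals S (otherTeams n) i := by
  classical
  rw [goals, goals, goals, ← Finset.sum_filter_add_sum_filter_not _ (fun p => p.1.2.val = 0),
    Finset.filter_filter, Finset.filter_filter]
  simp [firstTeam, otherTeams]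

section Ordered

theorem entry_nonneg {R : Type*} [CommRing R] [LinearOrder R] {S : Pos n → R}
    (hS : ∀ c, 0 ≤ slack R c S) (p : Pos n) : 0 ≤ S p := hS (.inl p)

variable {R : Type*} [CommRing R] [LinearOrder R] [IsStrictOrderedRing R] {S : Pos n → R}

theorem goals_nonneg (hS : ∀ p, 0 ≤ S p) (K : Finset (Fin n)) (i : Fin n) : 0 ≤ goals S K i :=
  Finset.sum_nonneg fun p _ => hS p

theorem goals_mono (hS : ∀ p, 0 ≤ S p) {K L : Finset (Fin n)} (h : K ⊆ L) (i : Fin n) :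
    goals S K i ≤ goals S L i := by
  refine Finset.sum_le_sum_of_subset_of_nonneg (fun p hp => ?_) fun p _ _ => hS p
  simp only [Finset.mem_filter, Finset.mem_univ, true_and] at hp ⊢
  exact ⟨hp.1, h hp.2⟩

theorem goals_pos_iff (hS : ∀ p, 0 ≤ S p) {K : Finset (Fin n)} {i : Fin n} :
    0 < goals S K i ↔ ∃ p : Pos n, p.1.1 = i ∧ p.1.2 ∈ K ∧ 0 < S p := by
  rw [goals, Finset.sum_pos_iff_of_nonneg fun p _ => hS p]
  simp [and_assoc]

theorem goals_univ_antitone (hS : ∀ c, 0 ≤ slack R c S) : Antitone (goals S Finset.univ) :=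
  fun i j hij => sub_nonneg.1 (hS (.inr (.inl ⟨(i, j), hij⟩)))

/-- Since `T_1` does not play against itself, its goals fit into the order after the deletion of
the first column, although the first row is deleted as well. -/
theorem goals_otherTeams_antitone (hS : ∀ c, 0 ≤ slack R c S) :
    Antitone (goals S (otherTeams n)) := by
  intro i j hij
  -- Only the comparison of `T_1` with another team is not among the defining inequalities.
  by_cases hj : j.val = 0
  · have : i = j := Fin.ext (by have : i.val ≤ j.val := hij; omega)
    rw [this]
  by_cases hi : i.val = 0
  · have h0 : goals S (firstTeam n) i = 0 := by
      refine Finset.sum_eq_zero fun p hp => (p.2 (Fin.ext ?_)).elim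
      simp only [firstTeam, Finset.mem_filter, Finset.mem_univ, true_and] at hp
      rw [hp.1, hp.2, hi]
    have h1 := goals_univ_eq S i
    rw [h0, zero_add] at h1
    rw [← h1]
    exact (goals_mono (entry_nonneg hS) (Finset.subset_univ _) j).trans (goals_univ_antitone hS hij)
  · exact sub_nonneg.1 (hS (.inr (.inr ⟨(i, j), by simpa [otherTeams] using hi,
      by simpa [otherTeams] using hj, hij⟩)))

theorem degOne_nonneg (hS : ∀ c, 0 ≤ slack R c S) : 0 ≤ degOne S :=
  Finset.sum_nonneg fun _ _ => goals_nonneg (entry_nonneg hS) _ _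

theorem entry_le_goals (hS : ∀ p, 0 ≤ S p) (p : Pos n) : S p ≤ goals S Finset.univ p.1.1 :=
  Finset.single_le_sum (f := S) (fun p _ => hS p) (by simp)

theorem entry_le_degOne (hS : ∀ c, 0 ≤ slack R c S) (p : Pos n) : S p ≤ degOne S := by
  have hn : 0 < n := p.1.1.pos
  rw [degOne_eq hn]
  exact (entry_le_goals (entry_nonneg hS) p).trans
    (goals_univ_antitone hS (Fin.mk_le_of_le_val (Nat.zero_le _)))

theorem eq_zero_of_degOne_eq_zero (hS : ∀ c, 0 ≤ slack R c S) (h : degOne S = 0) : S = 0 := by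
  funext p
  exact le_antisymm ((entry_le_degOne hS p).trans_eq h) (entry_nonneg hS p)

theorem degOne_pos (hS : ∀ c, 0 ≤ slack R c S) (h : S ≠ 0) : 0 < degOne S :=
  (degOne_nonneg hS).lt_of_ne fun e => h (eq_zero_of_degOne_eq_zero hS e.symm)

end Ordered

end Slack

/-! ### Score sheets with at most one goal for each team -/

section Sheet

variable {n : ℕ}

/-- The score sheet in which every team `i` scored one goal, against `f i`. The fixed points of `f`
are the teams that scored no goal. -/
def sheet (f : Fin n → Fin n) : Pos n → ℤ := fun p => if f p.1.1 = p.1.2 then 1 else 0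

/-- The functions `f` for which, in the score sheet of `f`, the first `r` teams scored a goal
against a team different from `T_1`, the next `q - r` teams scored a goal against `T_1`, and the
other teams scored no goal. -/
def patterns (n r q : ℕ) : Finset (Fin n → Fin n) :=
  Fintype.piFinset fun i => if i.val < r then Finset.univ.filter fun j => j ≠ i ∧ j.val ≠ 0
    else if i.val < q then firstTeam n else {i}

/-- `f` belongs to `patterns n r q`, where `1 ≤ r ≤ q ≤ n`. This is the condition for the score
sheet of `f` to belong to `A_n` (if `r = q`) or to `B_n` (if `r < q`) with these parameters. -/
structure IsPattern (r q : ℕ) (f : Fin n → Fin n) : Prop where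
  one_le : 1 ≤ r
  le : r ≤ q
  le_n : q ≤ n
  mem : f ∈ patterns n r q

theorem mem_patterns {r q : ℕ} (hrq : r ≤ q) {f : Fin n → Fin n} :
    f ∈ patterns n r q ↔ ∀ i, (i.val < r → f i ≠ i ∧ (f i).val ≠ 0) ∧
      (r ≤ i.val → i.val < q → (f i).val = 0) ∧ (q ≤ i.val → f i = i) := by
  simp only [patterns, Fintype.mem_piFinset]
  refine forall_congr' fun i => ?_
  rcases lt_or_ge i.val r with h | h
  · have h2 : ¬ q ≤ i.val := by omega
    simp [h, h2]
  · rcases lt_or_ge i.val q with h2 | h2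
    · simp [h, h.not_gt, h2, h2.not_ge, firstTeam]
    · simp [h.not_gt, h2.not_gt, h2]

theorem goals_sheet (f : Fin n → Fin n) (K : Finset (Fin n)) (i : Fin n) :
    goals (sheet f) K i = if f i ≠ i ∧ f i ∈ K then 1 else 0 := by
  split_ifs with h
  · rw [goals, Finset.sum_eq_single (⟨(i, f i), h.1.symm⟩ : Pos n)]
    · simp [sheet]
    · rintro ⟨⟨a, b⟩, hab⟩ hp hne
      simp only [Finset.mem_filter, Finset.mem_univ, true_and] at hp
      obtain ⟨rfl, _⟩ := hp
      refine if_neg fun e => hne ?_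
      simp only at e
      subst e
      rfl
    · simp [h.2]
  · refine Finset.sum_eq_zero ?_
    rintro ⟨⟨a, b⟩, hab⟩ hp
    simp only [Finset.mem_filter, Finset.mem_univ, true_and] at hp
    obtain ⟨rfl, hb⟩ := hp
    refine if_neg fun e => h ?_
    simp only at e
    subst e
    exact ⟨Ne.symm hab, hb⟩

/-- A score sheet in which every team scored at most one goal is the score sheet of a function. -/
theorem exists_eq_sheet {S : Pos n → ℤ} (hS : ∀ p, 0 ≤ S p)
    (h : ∀ i, goals S Finset.univ i = 0 ∨ goals S Finset.univ i = 1) : ∃ f, S = sheet f := by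
  have key (i : Fin n) : ∃ j, ∀ p : Pos n, p.1.1 = i → S p = if j = p.1.2 then 1 else 0 := by
    rcases h i with h0 | h1
    · refine ⟨i, fun p hp => ?_⟩
      rw [if_neg fun e => p.2 (hp.trans e)]
      exact (Finset.sum_eq_zero_iff_of_nonneg fun p _ => hS p).1 h0 p (by simpa using hp)
    · obtain ⟨p, hp, -, hpos⟩ := (goals_pos_iff hS).1 (h1 ▸ one_pos)
      refine ⟨p.1.2, fun p' hp' => ?_⟩
      have hsum : ∑ x ∈ Finset.univ.filter (fun x : Pos n => x.1.1 = i), S x = 1 := by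
        simpa [goals] using h1
      have hmem : p ∈ Finset.univ.filter (fun x : Pos n => x.1.1 = i) := by simpa using hp
      rw [← Finset.add_sum_erase _ _ hmem] at hsum
      have hnn : 0 ≤ ∑ x ∈ (Finset.univ.filter (fun x : Pos n => x.1.1 = i)).erase p, S x :=
        Finset.sum_nonneg fun x _ => hS x
      have hz : ∑ x ∈ (Finset.univ.filter (fun x : Pos n => x.1.1 = i)).erase p, S x = 0 := by
        omega
      split_ifs with e
      · have : p' = p := Subtype.ext (Prod.ext (hp'.trans hp.symm) e.symm)
        rw [this]
        omega
      · refine (Finset.sum_eq_zero_iff_of_nonneg fun x _ => hS x).1 hz p' ?_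
        simp only [Finset.mem_erase, Finset.mem_filter, Finset.mem_univ, true_and]
        exact ⟨fun h => e (h ▸ rfl), hp'⟩
  choose f hf using key
  exact ⟨f, funext fun p => hf _ p rfl⟩

theorem sheet_injective : Function.Injective (sheet : (Fin n → Fin n) → Pos n → ℤ) := by
  intro f g h
  funext i
  by_contra hne
  have key {f g : Fin n → Fin n} (h : sheet f = sheet g) (hfi : f i ≠ i) : f i = g i := by
    have := congrFun h ⟨(i, f i), hfi.symm⟩
    by_contra hne
    simp [sheet, Ne.symm hne] at this
  by_cases hf : f i = i
  · exact hne (key h.symm fun hg => hne (hf.trans hg.symm)).symm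
  · exact hne (key h hf)

namespace IsPattern

variable {r q : ℕ} {f : Fin n → Fin n}

theorem goals_univ (h : IsPattern r q f) (i : Fin n) :
    goals (sheet f) Finset.univ i = if i.val < q then 1 else 0 := by
  have h0 := (mem_patterns h.le).1 h.mem i
  have h1 := h.one_le
  rw [goals_sheet]
  refine if_congr ⟨fun hi => ?_, fun hi => ⟨?_, Finset.mem_univ _⟩⟩ rfl rfl
  · by_contra hq
    exact hi.1 (h0.2.2 (not_lt.1 hq))
  · rcases lt_or_ge i.val r with hr | hr
    · exact (h0.1 hr).1
    · intro e
      have := h0.2.1 hr hi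
      rw [e] at this
      omega

theorem goals_otherTeams (h : IsPattern r q f) (i : Fin n) :
    goals (sheet f) (otherTeams n) i = if i.val < r then 1 else 0 := by
  have h0 := (mem_patterns h.le).1 h.mem i
  rw [goals_sheet]
  refine if_congr ⟨fun hi => ?_, fun hi => ⟨(h0.1 hi).1, by simpa [otherTeams] using (h0.1 hi).2⟩⟩
    rfl rfl
  by_contra hr
  rcases lt_or_ge i.val q with hq | hq
  · have : (f i).val ≠ 0 := by simpa [otherTeams] using hi.2
    exact this (h0.2.1 (not_lt.1 hr) hq)
  · exact hi.1 (h0.2.2 hq)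

theorem slack_eq (h : IsPattern r q f) (c : Inequality n) :
    slack ℤ c (sheet f) = 0 ∨ slack ℤ c (sheet f) = 1 := by
  rcases c with p | ⟨p, hp⟩ | ⟨p, hp⟩
  · simp only [slack_inl, sheet]
    split_ifs <;> simp
  · rw [slack_inr_inl, h.goals_univ, h.goals_univ]
    have : p.1.val ≤ p.2.val := hp
    dsimp only
    split_ifs <;> omega
  · rw [slack_inr_inr, h.goals_otherTeams, h.goals_otherTeams]
    have : p.1.val ≤ p.2.val := hp.2.2
    dsimp only
    split_ifs <;> omega

theorem slack_nonneg (h : IsPattern r q f) (c : Inequality n) : 0 ≤ slack ℤ c (sheet f) := by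
  rcases h.slack_eq c with e | e <;> simp [e]

theorem pos (h : IsPattern r q f) : 0 < n := by
  have := h.one_le
  have := h.le
  have := h.le_n
  omega

theorem degOne_eq_one (h : IsPattern r q f) : degOne (sheet f) = 1 := by
  rw [degOne_eq h.pos, h.goals_univ, if_pos]
  exact lt_of_lt_of_le h.one_le h.le

/-- The inequalities that are tight at the score sheet of a pattern determine it up to a factor. -/
theorem eq_smul_of_slack_eq_zero (h : IsPattern r q f) {x : Pos n → ℝ}
    (hx : ∀ c, slack ℤ c (sheet f) = 0 → slack ℝ c x = 0) :
    x = degOne x • latticeEmb (sheet f) := by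
  funext p
  have hzero (p : Pos n) (hp : f p.1.1 ≠ p.1.2) : x p = 0 := hx (.inl p) (if_neg hp)
  by_cases hp : f p.1.1 = p.1.2
  · have hlt : p.1.1.val < q := by
      by_contra hq
      exact p.2 ((((mem_patterns h.le).1 h.mem p.1.1).2.2 (not_lt.1 hq)).symm.trans hp)
    have h1 := hx (.inr (.inl ⟨(⟨0, h.pos⟩, p.1.1), Nat.zero_le _⟩)) (by
      rw [slack_inr_inl, h.goals_univ, h.goals_univ, if_pos hlt,
        if_pos (lt_of_lt_of_le h.one_le h.le), sub_self])
    rw [slack_inr_inl, sub_eq_zero, ← degOne_eq] at h1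
    have h2 : goals x Finset.univ p.1.1 = x p := by
      refine Finset.sum_eq_single p (fun p' hp' hne => hzero p' fun e => hne ?_) (by simp)
      simp only [Finset.mem_filter, Finset.mem_univ, true_and, and_true] at hp'
      refine Subtype.ext (Prod.ext hp' ?_)
      rw [← e, hp', hp]
    simp only at h1
    rw [Pi.smul_apply, h1, h2]
    simp [latticeEmb, sheet, hp]
  · rw [hzero p hp]
    simp [latticeEmb, sheet, hp]

end IsPattern

theorem exists_forall_iff_lt {P : Fin n → Prop} (hP : ∀ i j, i ≤ j → P j → P i) :
    ∃ r ≤ n, ∀ i : Fin n, P i ↔ i.val < r := by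
  classical
  by_cases h : ∃ m, ∃ hm : m < n, ¬ P ⟨m, hm⟩
  · obtain ⟨hm, hmP⟩ := Nat.find_spec h
    refine ⟨Nat.find h, hm.le, fun i => ⟨fun hi => ?_, fun hi => ?_⟩⟩
    · by_contra hlt
      exact hmP (hP _ _ (Fin.mk_le_of_le_val (not_lt.1 hlt)) hi)
    · by_contra hPi
      exact Nat.find_min h hi ⟨i.2, hPi⟩
  · push Not at h
    exact ⟨n, le_rfl, fun i => ⟨fun _ => i.2, fun _ => h i.val i.2⟩⟩

/-- Every nonzero point of the cone has a score sheet in `A_n` or `B_n` below it, in the sense that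
all inequalities tight at the point are tight at the score sheet. The numbers `r` and `q` count the
teams with a positive number of goals after and before the deletion of the first column. -/
theorem exists_isPattern {x : Pos n → ℝ} (hx : ∀ c, 0 ≤ slack ℝ c x) (h0 : x ≠ 0) :
    ∃ r q f, IsPattern r q f ∧ ∀ c, slack ℝ c x = 0 → slack ℤ c (sheet f) = 0 := by
  classical
  have hx0 := entry_nonneg hx
  have hd := degOne_pos hx h0
  have hn : 0 < n := by
    by_contra hn
    exact h0 (funext fun p => (hn p.1.1.pos).elim)
  obtain ⟨r, hr, hri⟩ := exists_forall_iff_lt (P := fun i => 0 < goals x (otherTeams n) i)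
    fun i j hij hj => hj.trans_le (goals_otherTeams_antitone hx hij)
  obtain ⟨q, hq, hqi⟩ := exists_forall_iff_lt (P := fun i => 0 < goals x Finset.univ i)
    fun i j hij hj => hj.trans_le (goals_univ_antitone hx hij)
  have hrq : r ≤ q := by
    by_contra hlt
    push Not at hlt
    have h1 := (hri ⟨q, by omega⟩).2 hlt
    have h2 := (hqi ⟨q, by omega⟩).1 (h1.trans_le (goals_mono hx0 (Finset.subset_univ _) _))
    simp at h2
  have h1r : 1 ≤ r := by
    rw [degOne_eq hn, goals_pos_iff hx0] at hd
    obtain ⟨p, hp1, -, hp⟩ := hd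
    refine (hri ⟨0, hn⟩).1 ((goals_pos_iff hx0).2 ⟨p, hp1, ?_, hp⟩)
    simp only [otherTeams, Finset.mem_filter, Finset.mem_univ, true_and]
    intro e
    exact p.2 (hp1.trans (Fin.ext e.symm))
  have key (i : Fin n) : ∃ j, ((i.val < r → j ≠ i ∧ j.val ≠ 0) ∧
      (r ≤ i.val → i.val < q → j.val = 0) ∧ (q ≤ i.val → j = i)) ∧
      ∀ hij : i ≠ j, 0 < x ⟨(i, j), hij⟩ := by
    rcases lt_or_ge i.val r with h | h
    · obtain ⟨⟨⟨a, j⟩, hp⟩, hai, hj, hpos⟩ := (goals_pos_iff hx0).1 ((hri i).2 h)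
      obtain rfl : a = i := hai
      simp only at hp hj
      refine ⟨j, ⟨fun _ => ⟨Ne.symm hp, by simpa [otherTeams] using hj⟩, ?_, ?_⟩, fun _ => hpos⟩
      · intro h'; omega
      · intro h'; omega
    rcases lt_or_ge i.val q with h' | h'
    · obtain ⟨⟨⟨a, j⟩, hp⟩, hai, -, hpos⟩ := (goals_pos_iff hx0).1 ((hqi i).2 h')
      obtain rfl : a = i := hai
      simp only at hp
      refine ⟨j, ⟨fun _ => by omega, fun _ _ => ?_, fun _ => by omega⟩, fun _ => hpos⟩
      by_contra hj
      refine h.not_gt ((hri a).1 ((goals_pos_iff hx0).2 ⟨_, rfl, ?_, hpos⟩))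
      simpa [otherTeams] using hj
    · exact ⟨i, ⟨fun _ => by omega, fun _ _ => by omega, fun _ => rfl⟩, fun e => (e rfl).elim⟩
  choose f hf hpos using key
  have hpat : IsPattern r q f := ⟨h1r, hrq, hq, (mem_patterns hrq).2 hf⟩
  refine ⟨r, q, f, hpat, fun c hc => ?_⟩
  rcases c with ⟨⟨i, j⟩, hij⟩ | ⟨⟨i, j⟩, hij⟩ | ⟨⟨i, j⟩, hi, hj, hij⟩
  · refine if_neg fun e => ?_
    simp only at e
    subst e
    exact (hpos i hij).ne' hc
  · rw [slack_inr_inl, sub_eq_zero] at hc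
    rw [slack_inr_inl, hpat.goals_univ, hpat.goals_univ, sub_eq_zero]
    refine if_congr ?_ rfl rfl
    rw [← hqi, ← hqi]
    simp only at hc
    simp only [hc]
  · rw [slack_inr_inr, sub_eq_zero] at hc
    rw [slack_inr_inr, hpat.goals_otherTeams, hpat.goals_otherTeams, sub_eq_zero]
    refine if_congr ?_ rfl rfl
    rw [← hri, ← hri]
    simp only at hc
    simp only [hc]

end Sheet

/-! ### The sets `A_n` and `B_n` in terms of patterns -/

section PatternSheets

variable {n : ℕ}

/-- The score sheets of all patterns, that is, the union of `A_n` and `B_n`. -/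
def patternSheets (n : ℕ) : Set (Pos n → ℤ) := {S | ∃ r q f, IsPattern r q f ∧ S = sheet f}

theorem IsPattern.sheet_mem {r q : ℕ} {f : Fin n → Fin n} (h : IsPattern r q f) :
    sheet f ∈ patternSheets n := ⟨r, q, f, h, rfl⟩

theorem IsPattern.mem_runnerUpConsistent {r q : ℕ} {f : Fin n → Fin n} (h : IsPattern r q f) :
    sheet f ∈ runnerUpConsistent n := _root_.mem_runnerUpConsistent.2 h.slack_nonneg

theorem IsPattern.exists_sheet_eq_one {r q : ℕ} {f : Fin n → Fin n} (hf : IsPattern r q f) :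
    ∃ p, sheet f p = 1 :=
  ⟨⟨(⟨0, hf.pos⟩, f ⟨0, hf.pos⟩), fun e =>
    (((mem_patterns hf.le).1 hf.mem ⟨0, hf.pos⟩).1 hf.one_le).1 e.symm⟩, by simp [sheet]⟩

/-- The condition that defines `B_n`, with `r = q` allowed. For `r = q` the middle clause is void,
and it is the condition that defines `A_n`. -/
theorem exists_isPattern_iff {r q : ℕ} (h1 : 1 ≤ r) (hrq : r ≤ q) (hq : q ≤ n) {S : Pos n → ℤ} :
    (∃ f, IsPattern r q f ∧ S = sheet f) ↔ S ∈ orderedScoreSheets n ∧ ∀ i : Fin n,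
      (i.val < r → ScoresOnceAgainstOthers S i) ∧
      (r ≤ i.val → i.val < q → ScoresOnceAgainstFirst S i) ∧
      (q ≤ i.val → ScoresNothing S i) := by
  constructor
  · rintro ⟨f, hf, rfl⟩
    refine ⟨hf.mem_runnerUpConsistent.1, fun i => ?_⟩
    have e1 := hf.goals_univ i
    have e2 := hf.goals_otherTeams i
    have e3 := goals_univ_eq (sheet f) i
    simp only [ScoresOnceAgainstOthers, ScoresOnceAgainstFirst, ScoresNothing]
    split_ifs at e1 e2 <;> omega
  · rintro ⟨hS, h⟩
    obtain ⟨f, rfl⟩ := exists_eq_sheet hS.1 fun i => by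
      have := h i
      have e3 := goals_univ_eq S i
      simp only [ScoresOnceAgainstOthers, ScoresOnceAgainstFirst, ScoresNothing] at this
      omega
    refine ⟨f, ⟨h1, hrq, hq, (mem_patterns hrq).2 fun i => ?_⟩, rfl⟩
    obtain ⟨ha, hb, hc⟩ := h i
    simp only [ScoresOnceAgainstOthers, ScoresOnceAgainstFirst, ScoresNothing, goals_sheet,
      otherTeams, firstTeam, Finset.mem_filter, Finset.mem_univ, true_and, and_true] at ha hb hc
    refine ⟨fun hi => ?_, fun hi hi' => ?_, fun hi => ?_⟩
    · by_contra hn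
      simp [hn] at ha
      omega
    · by_contra hn
      have := (hb hi hi').1
      simp [hn] at this
    · by_contra hn
      have := hc hi
      simp [hn] at this

theorem mem_setA_iff {S : Pos n → ℤ} : S ∈ setA n ↔ ∃ r f, IsPattern r r f ∧ S = sheet f := by
  constructor
  · rintro ⟨hS, r, h1, hr, h⟩
    exact ⟨r, (exists_isPattern_iff h1 le_rfl hr).2
      ⟨hS, fun i => ⟨(h i).1, fun h1 h2 => absurd h2 h1.not_gt, (h i).2⟩⟩⟩
  · rintro ⟨r, f, hf, rfl⟩
    obtain ⟨hS, h⟩ := (exists_isPattern_iff hf.one_le le_rfl hf.le_n).1 ⟨f, hf, rfl⟩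
    exact ⟨hS, r, hf.one_le, hf.le_n, fun i => ⟨(h i).1, (h i).2.2⟩⟩

theorem mem_setB_iff {S : Pos n → ℤ} :
    S ∈ setB n ↔ ∃ r q f, r < q ∧ IsPattern r q f ∧ S = sheet f := by
  constructor
  · rintro ⟨hS, r, q, h1, hr, hq, h⟩
    obtain ⟨f, hf⟩ := (exists_isPattern_iff h1 hr.le hq).2 ⟨hS, h⟩
    exact ⟨r, q, f, hr, hf⟩
  · rintro ⟨r, q, f, hrq, hf, rfl⟩
    obtain ⟨hS, h⟩ := (exists_isPattern_iff hf.one_le hf.le hf.le_n).1 ⟨f, hf, rfl⟩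
    exact ⟨hS, r, q, hf.one_le, hrq, hf.le_n, h⟩

theorem setA_union_setB : setA n ∪ setB n = patternSheets n := by
  ext S
  rw [Set.mem_union, mem_setA_iff, mem_setB_iff]
  constructor
  · rintro (⟨r, f, h⟩ | ⟨r, q, f, -, h⟩)
    · exact ⟨r, r, f, h⟩
    · exact ⟨r, q, f, h⟩
  · rintro ⟨r, q, f, hf, h⟩
    rcases hf.le.eq_or_lt with rfl | hlt
    · exact Or.inl ⟨r, f, hf, h⟩
    · exact Or.inr ⟨r, q, f, hlt, hf, h⟩

theorem finite_patternSheets : (patternSheets n).Finite := by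
  refine (Set.finite_range sheet).subset ?_
  rintro _ ⟨r, q, f, -, rfl⟩
  exact ⟨f, rfl⟩

end PatternSheets

/-! ### The Hilbert basis -/

section HilbertBasis

variable {n : ℕ}

theorem latticeEmb_ne_zero {ι : Type*} {z : ι → ℤ} (hz : z ≠ 0) : latticeEmb z ≠ 0 := by
  intro h
  refine hz (latticeEmb_injective (h.trans ?_))
  ext i
  simp [latticeEmb]

theorem exists_sub_sheet_mem {S : Pos n → ℤ} (hS : S ∈ runnerUpConsistent n) (h0 : S ≠ 0) :
    ∃ r q f, IsPattern r q f ∧ S - sheet f ∈ runnerUpConsistent n := by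
  rw [mem_runnerUpConsistent] at hS
  obtain ⟨r, q, f, hf, h⟩ := exists_isPattern (x := latticeEmb S)
    (fun c => by rw [slack_latticeEmb]; exact_mod_cast hS c) (latticeEmb_ne_zero h0)
  refine ⟨r, q, f, hf, mem_runnerUpConsistent.2 fun c => ?_⟩
  rw [map_sub]
  have h1 := hS c
  rcases hf.slack_eq c with e | e
  · omega
  · have : slack ℤ c S ≠ 0 := fun e' => by
      have := h c (by rw [slack_latticeEmb, e', Int.cast_zero])
      omega
    omega

theorem closure_patternSheets :
    AddSubmonoid.closure (patternSheets n) = runnerUpConsistent n := by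
  apply le_antisymm
  · refine AddSubmonoid.closure_le.2 ?_
    rintro _ ⟨r, q, f, hf, rfl⟩
    exact hf.mem_runnerUpConsistent
  · suffices h : ∀ (m : ℕ) (S : Pos n → ℤ), S ∈ runnerUpConsistent n → degOne S = m →
        S ∈ AddSubmonoid.closure (patternSheets n) by
      intro S hS
      exact h (degOne S).toNat S hS
        (Int.toNat_of_nonneg (degOne_nonneg (mem_runnerUpConsistent.1 hS))).symm
    intro m
    induction m with
    | zero =>
      intro S hS h
      rw [eq_zero_of_degOne_eq_zero (mem_runnerUpConsistent.1 hS) h]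
      exact zero_mem _
    | succ m ih =>
      intro S hS h
      have h0 : S ≠ 0 := by
        rintro rfl
        rw [← degOneLin_apply, map_zero] at h
        omega
      obtain ⟨r, q, f, hf, hmem⟩ := exists_sub_sheet_mem hS h0
      rw [← sub_add_cancel S (sheet f)]
      refine add_mem (ih _ hmem ?_) (AddSubmonoid.subset_closure hf.sheet_mem)
      rw [← degOneLin_apply, map_sub, degOneLin_apply, degOneLin_apply, h, hf.degOne_eq_one]
      push_cast
      ring

theorem eq_zero_of_isAddUnit {S : runnerUpConsistent n} (h : IsAddUnit S) : S = 0 := by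
  obtain ⟨T, hT⟩ := h.exists_neg
  have h1 := degOne_nonneg (mem_runnerUpConsistent.1 S.2)
  have h2 := degOne_nonneg (mem_runnerUpConsistent.1 T.2)
  have h3 : degOne (S : Pos n → ℤ) + degOne (T : Pos n → ℤ) = 0 := by
    rw [← degOneLin_apply, ← degOneLin_apply, ← map_add, ← AddSubmonoid.coe_add, hT,
      AddSubmonoid.coe_zero, map_zero]
  exact Subtype.ext (eq_zero_of_degOne_eq_zero (mem_runnerUpConsistent.1 S.2) (by omega))

theorem hilbertBasis_eq : hilbertBasis (runnerUpConsistent n) = patternSheets n := by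
  ext S
  constructor
  · rintro ⟨hS, hirr⟩
    have h0 : S ≠ 0 := by
      rintro rfl
      exact hirr.not_isAddUnit isAddUnit_zero
    obtain ⟨r, q, f, hf, hmem⟩ := exists_sub_sheet_mem hS h0
    have hf0 : sheet f ≠ 0 := by
      intro h
      have := hf.degOne_eq_one
      rw [h, ← degOneLin_apply, map_zero] at this
      exact zero_ne_one this
    rcases hirr.isAddUnit_or_isAddUnit (a := ⟨_, hmem⟩) (b := ⟨_, hf.mem_runnerUpConsistent⟩)
      (Subtype.ext (sub_add_cancel S (sheet f)).symm) with h | h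
    · have := congrArg Subtype.val (eq_zero_of_isAddUnit h)
      exact sub_eq_zero.1 this ▸ hf.sheet_mem
    · exact (hf0 (congrArg Subtype.val (eq_zero_of_isAddUnit h))).elim
  · rintro ⟨r, q, f, hf, rfl⟩
    refine ⟨hf.mem_runnerUpConsistent, ⟨fun h => ?_, fun a b hab => ?_⟩⟩
    · have h1 := congrArg Subtype.val (eq_zero_of_isAddUnit h)
      have h2 := hf.degOne_eq_one
      simp only [AddSubmonoid.coe_zero] at h1
      rw [h1, ← degOneLin_apply, map_zero] at h2
      exact zero_ne_one h2
    · have ha := mem_runnerUpConsistent.1 a.2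
      have hb := mem_runnerUpConsistent.1 b.2
      have h := hf.degOne_eq_one
      rw [show sheet f = a + b from congrArg Subtype.val hab, ← degOneLin_apply, map_add,
        degOneLin_apply, degOneLin_apply] at h
      have h1 := degOne_nonneg ha
      have h2 := degOne_nonneg hb
      rcases (show degOne (a : Pos n → ℤ) = 0 ∨ degOne (b : Pos n → ℤ) = 0 by omega) with e | e
      · left
        rw [show a = 0 from Subtype.ext (eq_zero_of_degOne_eq_zero ha e)]
        exact isAddUnit_zero
      · right
        rw [show b = 0 from Subtype.ext (eq_zero_of_degOne_eq_zero hb e)]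
        exact isAddUnit_zero

/-- If `0` is the only invertible element of a monoid of lattice points, then every system of
generators contains the irreducible elements. -/
theorem hilbertBasis_subset_of_closure_eq {ι : Type*} {M : AddSubmonoid (ι → ℤ)}
    (hM : ∀ x : M, IsAddUnit x → x = 0) {G : Set (ι → ℤ)} (hG : AddSubmonoid.closure G = M) :
    hilbertBasis M ⊆ G := by
  rintro x ⟨hx, hirr⟩
  rw [← hG] at hx
  induction hx using AddSubmonoid.closure_induction with
  | mem x hxG => exact hxG
  | zero => exact (hirr.not_isAddUnit isAddUnit_zero).elim
  | add a b ha hb iha ihb =>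
    rw [hG] at ha hb
    rcases hirr.isAddUnit_or_isAddUnit (a := ⟨a, ha⟩) (b := ⟨b, hb⟩) rfl with h | h
    · have h0 : a = 0 := congrArg Subtype.val (hM _ h)
      subst h0
      simp only [zero_add] at hirr ⊢
      exact ihb hb hirr
    · have h0 : b = 0 := congrArg Subtype.val (hM _ h)
      subst h0
      simp only [add_zero] at hirr ⊢
      exact iha ha hirr

end HilbertBasis

/-! ### The cone and the polytope -/

section Cone

variable {n : ℕ}

/-- Every nonzero point of the cone is a multiple of a convex combination of score sheets of
patterns. One subtracts the largest possible multiple of the score sheet of a pattern that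
satisfies all tight inequalities with equality; this makes at least one more inequality tight. -/
theorem exists_eq_smul_of_slack_nonneg (m : ℕ) : ∀ x : Pos n → ℝ, (∀ c, 0 ≤ slack ℝ c x) → x ≠ 0 →
    {c : Inequality n | slack ℝ c x ≠ 0}.ncard = m →
    ∃ y ∈ convexHull ℝ (latticeEmb '' patternSheets n), x = degOne x • y := by
  classical
  induction m using Nat.strong_induction_on with
  | _ m ih =>
  intro x hx h0 hm
  obtain ⟨r, q, f, hf, htight⟩ := exists_isPattern hx h0
  have hmem := subset_convexHull ℝ _ (Set.mem_image_of_mem latticeEmb hf.sheet_mem)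
  have hsh (c : Inequality n) := slack_latticeEmb c (sheet f)
  have hne : (Finset.univ.filter fun c : Inequality n => slack ℤ c (sheet f) = 1).Nonempty := by
    obtain ⟨p, hp⟩ := hf.exists_sheet_eq_one
    exact ⟨.inl p, by simpa using hp⟩
  obtain ⟨c, hc, hmin⟩ := Finset.exists_min_image _ (fun c => slack ℝ c x) hne
  simp only [Finset.mem_filter, Finset.mem_univ, true_and] at hc hmin
  set t := slack ℝ c x with ht
  have htpos : 0 < t := (hx c).lt_of_ne fun e => by
    have := htight c e.symm
    omega
  set x' := x - t • latticeEmb (sheet f) with hx'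
  have hslack (c' : Inequality n) : slack ℝ c' x' = slack ℝ c' x - t * slack ℤ c' (sheet f) := by
    rw [hx', map_sub, map_smul, hsh, smul_eq_mul]
  have hx'0 (c' : Inequality n) : 0 ≤ slack ℝ c' x' := by
    rw [hslack]
    rcases hf.slack_eq c' with e | e
    · simpa [e] using hx c'
    · simpa [e] using hmin c' e
  have hdeg : degOne x = t + degOne x' := by
    rw [← degOneLin_apply, ← degOneLin_apply, hx', map_sub, map_smul, degOneLin_apply,
      degOneLin_apply, degOne_latticeEmb, hf.degOne_eq_one]
    simp
  by_cases hz : x' = 0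
  · refine ⟨_, hmem, ?_⟩
    rw [hdeg, hz, ← degOneLin_apply, map_zero, add_zero]
    exact sub_eq_zero.1 hz
  · have hlt : {c : Inequality n | slack ℝ c x' ≠ 0}.ncard < m := by
      rw [← hm]
      refine Set.ncard_lt_ncard ⟨fun c' hc' e => hc' ?_, fun h => ?_⟩ (Set.toFinite _)
      · rw [hslack, e, htight c' e]
        simp
      · have : slack ℝ c x' ≠ 0 := h (show slack ℝ c x ≠ 0 from htpos.ne')
        rw [hslack, hc] at this
        simp [ht] at this
    obtain ⟨y, hy, hxy⟩ := ih _ hlt x' hx'0 hz rfl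
    have hd := degOne_pos hx'0 hz
    refine ⟨(t / (t + degOne x')) • latticeEmb (sheet f) + (degOne x' / (t + degOne x')) • y,
      convex_convexHull ℝ _ hmem hy (by positivity) (by positivity) (by field_simp), ?_⟩
    have hsum : t + degOne x' ≠ 0 := by positivity
    rw [hdeg, smul_add, smul_smul, smul_smul, mul_div_cancel₀ _ hsum, mul_div_cancel₀ _ hsum,
      ← hxy, hx', add_sub_cancel]

theorem mem_coneOf_iff {x : Pos n → ℝ} :
    x ∈ coneOf (runnerUpConsistent n) ↔ ∀ c, 0 ≤ slack ℝ c x := by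
  constructor
  · intro hx c
    refine Submodule.span_induction (p := fun x _ => 0 ≤ slack ℝ c x) ?_ ?_ ?_ ?_ hx
    · rintro _ ⟨S, hS, rfl⟩
      rw [slack_latticeEmb]
      exact_mod_cast mem_runnerUpConsistent.1 hS c
    · simp
    · intro a b _ _ ha hb
      rw [map_add]
      exact add_nonneg ha hb
    · intro t a _ ha
      rw [Nonneg.mk_smul _ t.2, map_smul]
      exact mul_nonneg t.2 ha
  · intro hx
    by_cases h0 : x = 0
    · rw [h0]
      exact zero_mem (PointedCone.hull ℝ _)
    obtain ⟨y, hy, hxy⟩ := exists_eq_smul_of_slack_nonneg _ x hx h0 rfl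
    rw [hxy]
    refine Submodule.smul_mem (PointedCone.hull ℝ _) ⟨degOne x, degOne_nonneg hx⟩ ?_
    refine convexHull_min ?_ (PointedCone.hull ℝ _).convex hy
    rintro _ ⟨_, ⟨r, q, f, hf, rfl⟩, rfl⟩
    exact Submodule.subset_span ⟨_, hf.mem_runnerUpConsistent, rfl⟩

theorem convexHull_patternSheets :
    convexHull ℝ (latticeEmb '' patternSheets n) = faceOf (degOneLin n ℝ) (slack ℝ) ∅ := by
  apply Set.Subset.antisymm
  · refine convexHull_min ?_ convex_faceOf
    rintro _ ⟨_, ⟨r, q, f, hf, rfl⟩, rfl⟩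
    refine ⟨?_, fun c => ?_, fun _ h => h.elim⟩
    · rw [degOneLin_apply, degOne_latticeEmb, hf.degOne_eq_one, Int.cast_one]
    · rw [slack_latticeEmb]
      exact_mod_cast hf.slack_nonneg c
  · rintro x ⟨hd, hx, -⟩
    rw [degOneLin_apply] at hd
    obtain ⟨y, hy, hxy⟩ := exists_eq_smul_of_slack_nonneg _ x hx (by
      rintro rfl
      rw [← degOneLin_apply, map_zero] at hd
      exact zero_ne_one hd) rfl
    rw [hd, one_smul] at hxy
    exact hxy ▸ hy

theorem faceOf_eq_coneOf_inter : faceOf (degOneLin n ℝ) (slack ℝ) ∅ =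
    {x ∈ coneOf (runnerUpConsistent n) | degOne x = 1} := by
  ext x
  simp [faceOf, mem_coneOf_iff, and_comm]

theorem extremePoints_convexHull_patternSheets :
    (convexHull ℝ (latticeEmb '' patternSheets n)).extremePoints ℝ =
      latticeEmb '' patternSheets n := by
  refine extremePoints_convexHull_subset.antisymm ?_
  rintro _ ⟨_, ⟨r, q, f, hf, rfl⟩, rfl⟩
  have hmem := subset_convexHull ℝ _ (Set.mem_image_of_mem latticeEmb hf.sheet_mem)
  rw [convexHull_patternSheets] at hmem ⊢
  refine ⟨hmem, fun a ha b hb hab => ?_⟩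
  have hJ : latticeEmb (sheet f) ∈
      faceOf (degOneLin n ℝ) (slack ℝ) {c | slack ℤ c (sheet f) = 0} :=
    ⟨hmem.1, hmem.2.1, fun c hc => by rw [slack_latticeEmb, hc, Int.cast_zero]⟩
  have haJ := isExtreme_faceOf.left_mem_of_mem_openSegment ha hb hJ hab
  rw [hf.eq_smul_of_slack_eq_zero haJ.2.2, ← degOneLin_apply, haJ.1, one_smul]

theorem isCompressed_convexHull_patternSheets :
    IsCompressed (convexHull ℝ (latticeEmb '' patternSheets n)) := by
  refine ⟨⟨finite_patternSheets.toFinset, by simp⟩, fun ρ _ σ hσ => ?_⟩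
  have hext := extremePoints_convexHull_patternSheets (n := n)
  have hcomp := (finite_patternSheets (n := n)).image latticeEmb |>.isCompact_convexHull (𝕜 := ℝ)
  rw [convexHull_patternSheets] at hext hcomp hσ ⊢
  refine hσ.isUnimodularIn_faceOf hcomp (fun x hx => funext fun p => hx (.inl p))
    (fun c z => ⟨_, slack_latticeEmb c z⟩) ?_ ∅ rfl
  rw [hext]
  rintro _ ⟨_, ⟨r, q, f, hf, rfl⟩, rfl⟩
  refine ⟨⟨_, rfl⟩, fun c => ?_⟩
  rw [slack_latticeEmb]
  exact_mod_cast hf.slack_eq c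

end Cone

/-! ### Extreme integral generators -/

section ExtremeRays

variable {n : ℕ}

/-- The ray of the score sheet of a pattern is the face of the cone on which the sum of the linear
forms vanishing at the score sheet is zero. -/
theorem IsPattern.isExtremeRay {r q : ℕ} {f : Fin n → Fin n} (hf : IsPattern r q f) :
    IsExtremeRay (coneOf (runnerUpConsistent n))
      {x | ∃ t : ℝ, 0 ≤ t ∧ x = t • latticeEmb (sheet f)} := by
  classical
  have hslack (c : Inequality n) := slack_latticeEmb c (sheet f)
  constructor
  · intro _
    set L : (Pos n → ℝ) →ₗ[ℝ] ℝ := ∑ c with slack ℤ c (sheet f) = 0, slack ℝ c with hL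
    have hLapp (x : Pos n → ℝ) : L x = ∑ c with slack ℤ c (sheet f) = 0, slack ℝ c x := by
      simp [hL]
    have hLnn (x : Pos n → ℝ) (hx : ∀ c, 0 ≤ slack ℝ c x) : 0 ≤ L x := by
      rw [hLapp]
      exact Finset.sum_nonneg fun c _ => hx c
    refine ⟨-(LinearMap.toContinuousLinearMap L), ?_⟩
    ext x
    simp only [Set.mem_ofPred_eq, neg_apply, LinearMap.coe_toContinuousLinearMap', neg_le_neg_iff,
      mem_coneOf_iff]
    constructor
    · rintro ⟨t, ht, rfl⟩
      refine ⟨fun c => ?_, fun y hy => ?_⟩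
      · rw [map_smul, hslack]
        exact mul_nonneg ht (by exact_mod_cast hf.slack_nonneg c)
      · have : L (t • latticeEmb (sheet f)) = 0 := by
          rw [hLapp]
          refine Finset.sum_eq_zero fun c hc => ?_
          rw [map_smul, hslack, (Finset.mem_filter.1 hc).2]
          simp
        rw [this]
        exact hLnn y hy
    · rintro ⟨hx, hmax⟩
      have h0 := hmax 0 (by simp)
      rw [map_zero] at h0
      have h1 := le_antisymm h0 (hLnn x hx)
      rw [hLapp, Finset.sum_eq_zero_iff_of_nonneg fun c _ => hx c] at h1
      exact ⟨degOne x, degOne_nonneg hx,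
        hf.eq_smul_of_slack_eq_zero fun c hc => h1 c (by simpa using hc)⟩
  · have hspan : Submodule.span ℝ {x | ∃ t : ℝ, 0 ≤ t ∧ x = t • latticeEmb (sheet f)} =
        Submodule.span ℝ {latticeEmb (sheet f)} := by
      apply le_antisymm
      · refine Submodule.span_le.2 ?_
        rintro _ ⟨t, -, rfl⟩
        exact Submodule.smul_mem _ _ (Submodule.mem_span_singleton_self _)
      · refine Submodule.span_mono ?_
        rintro _ rfl
        exact ⟨1, zero_le_one, (one_smul _ _).symm⟩
    rw [hspan]
    refine finrank_span_singleton (latticeEmb_ne_zero fun h => ?_)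
    obtain ⟨p, hp⟩ := hf.exists_sheet_eq_one
    rw [h] at hp
    exact zero_ne_one hp

theorem extremeIntegralGenerators_eq :
    extremeIntegralGenerators (coneOf (runnerUpConsistent n)) = patternSheets n := by
  ext z
  constructor
  · rintro ⟨hgcd, hexp, -⟩
    have hzmem : latticeEmb z ∈ {x | ∃ t : ℝ, 0 ≤ t ∧ x = t • latticeEmb z} :=
      ⟨1, zero_le_one, (one_smul _ _).symm⟩
    have hz : z ∈ runnerUpConsistent n := mem_runnerUpConsistent.2 fun c => by
      have := mem_coneOf_iff.1 (hexp.subset hzmem) c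
      rw [slack_latticeEmb] at this
      exact_mod_cast this
    have h0 : z ≠ 0 := by
      rintro rfl
      have : Finset.univ.gcd (0 : Pos n → ℤ) = 0 := Finset.gcd_eq_zero_iff.2 fun _ _ => rfl
      rw [this] at hgcd
      exact zero_ne_one hgcd
    obtain ⟨r, q, f, hf, hmem⟩ := exists_sub_sheet_mem hz h0
    have hcone {S : Pos n → ℤ} (hS : S ∈ runnerUpConsistent n) :
        (2 : ℝ) • latticeEmb S ∈ coneOf (runnerUpConsistent n) := mem_coneOf_iff.2 fun c => by
      rw [map_smul, slack_latticeEmb]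
      exact mul_nonneg zero_le_two (by exact_mod_cast mem_runnerUpConsistent.1 hS c)
    -- The point `z` is the midpoint of twice the score sheet of `f` and twice the difference; as it
    -- lies on an extreme ray, so does the score sheet of `f`.
    obtain ⟨t, -, ht⟩ := hexp.isExtreme.left_mem_of_mem_openSegment
      (hcone hf.mem_runnerUpConsistent) (hcone hmem) hzmem
      ⟨1 / 2, 1 / 2, by norm_num, by norm_num, by norm_num, by
        rw [smul_smul, smul_smul, one_div, inv_mul_cancel₀ two_ne_zero, one_smul, one_smul,
          ← latticeEmb_add, add_sub_cancel]⟩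
    have hent (p : Pos n) : 2 * (sheet f p : ℝ) = t * z p := congrFun ht p
    obtain ⟨p, hp⟩ := hf.exists_sheet_eq_one
    have htp := hent p
    rw [hp] at htp
    -- Hence `z p` divides all entries of `z`.
    have hmul (p' : Pos n) : z p' = z p * sheet f p' := by
      have h := hent p'
      have : (z p' : ℝ) * 2 = z p * sheet f p' * 2 := by
        push_cast at htp
        linear_combination (z p' : ℝ) * htp - (z p : ℝ) * h
      exact_mod_cast mul_right_cancel₀ two_ne_zero this
    have hone : z p = 1 := by
      have hdvd : z p ∣ Finset.univ.gcd z := Finset.dvd_gcd fun p' _ => ⟨_, hmul p'⟩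
      rw [hgcd] at hdvd
      exact Int.eq_one_of_dvd_one (entry_nonneg (mem_runnerUpConsistent.1 hz) p) hdvd
    have : z = sheet f := funext fun p' => by rw [hmul, hone, one_mul]
    exact this ▸ hf.sheet_mem
  · rintro ⟨r, q, f, hf, rfl⟩
    refine ⟨?_, hf.isExtremeRay⟩
    obtain ⟨p, hp⟩ := hf.exists_sheet_eq_one
    have hdvd : Finset.univ.gcd (sheet f) ∣ 1 := hp ▸ Finset.gcd_dvd (Finset.mem_univ p)
    rw [← Finset.normalize_gcd]
    exact normalize_eq_one.2 (isUnit_of_dvd_one hdvd)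

end ExtremeRays

/-! ### Cardinalities -/

section Card

variable {n : ℕ}

theorem card_patterns {r q : ℕ} (h1 : 1 ≤ r) (hrq : r ≤ q) (hq : q ≤ n) :
    (patterns n r q).card = (n - 1) * (n - 2) ^ (r - 1) := by
  have hn : 0 < n := by omega
  have hcard (i : Fin n) : (if i.val < r then Finset.univ.filter fun j : Fin n => j ≠ i ∧ j.val ≠ 0
      else if i.val < q then firstTeam n else {i}).card =
      (fun i : ℕ => if i < r then (if i = 0 then n - 1 else n - 2) else 1) i.val := by
    dsimp only
    split_ifs with h h' h''
    · have : (Finset.univ.filter fun j : Fin n => j ≠ i ∧ j.val ≠ 0) = Finset.univ.erase i := by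
        ext j
        simp only [Finset.mem_filter, Finset.mem_univ, true_and, Finset.mem_erase, and_true]
        exact ⟨fun h => h.1, fun h => ⟨h, fun e => h (Fin.ext (e.trans h'.symm))⟩⟩
      rw [this, Finset.card_erase_of_mem (Finset.mem_univ _), Finset.card_univ, Fintype.card_fin]
    · have : (Finset.univ.filter fun j : Fin n => j ≠ i ∧ j.val ≠ 0) =
          (Finset.univ.erase i).erase ⟨0, hn⟩ := by
        ext j
        simp [Fin.ext_iff, and_comm]
      rw [this, Finset.card_erase_of_mem, Finset.card_erase_of_mem (Finset.mem_univ _),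
        Finset.card_univ, Fintype.card_fin, Nat.sub_sub]
      simp only [Finset.mem_erase, Finset.mem_univ, and_true]
      exact fun e => h' (Fin.ext_iff.1 e).symm
    · rw [firstTeam_eq hn, Finset.card_singleton]
    · rw [Finset.card_singleton]
  rw [patterns, Fintype.card_piFinset, Finset.prod_congr rfl fun i _ => hcard i,
    Fin.prod_univ_eq_prod_range (fun i => if i < r then (if i = 0 then n - 1 else n - 2) else 1) n]
  obtain ⟨k, hk⟩ := Nat.exists_eq_add_of_le (hrq.trans hq)
  obtain ⟨s, rfl⟩ := Nat.exists_eq_add_of_le' h1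
  rw [show Finset.range n = Finset.range (s + 1 + k) by rw [hk], Finset.prod_range_add,
    Finset.prod_range_succ']
  have e1 : ∏ i ∈ Finset.range k, (if s + 1 + i < s + 1 then
      (if s + 1 + i = 0 then n - 1 else n - 2) else 1) = 1 :=
    Finset.prod_eq_one fun i _ => if_neg (by omega)
  have e2 : ∏ i ∈ Finset.range s, (if i + 1 < s + 1 then
      (if i + 1 = 0 then n - 1 else n - 2) else 1) = (n - 2) ^ s := by
    rw [Finset.prod_congr rfl (g := fun _ => n - 2), Finset.prod_const, Finset.card_range]
    intro i hi
    rw [if_pos (by have := Finset.mem_range.1 hi; omega), if_neg (by omega)]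
  rw [e1, e2]
  simp [mul_comm]

/-- The numbers `r` and `q` are determined by the pattern. -/
theorem IsPattern.unique {r q r' q' : ℕ} {f : Fin n → Fin n} (h : IsPattern r q f)
    (h' : IsPattern r' q' f) : r = r' ∧ q = q' := by
  have key {a b : ℕ} (ha : a ≤ n) (hb : b ≤ n)
      (hab : ∀ i : Fin n, (if i.val < a then (1 : ℤ) else 0) = if i.val < b then 1 else 0) :
      a = b := by
    rcases lt_trichotomy a b with hlt | rfl | hlt
    · have := hab ⟨a, by omega⟩
      simp [hlt] at this
    · rfl
    · have := hab ⟨b, by omega⟩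
      simp [hlt] at this
  exact ⟨key (h.le.trans h.le_n) (h'.le.trans h'.le_n) fun i => by
      rw [← h.goals_otherTeams, h'.goals_otherTeams],
    key h.le_n h'.le_n fun i => by rw [← h.goals_univ, h'.goals_univ]⟩

theorem ncard_biUnion_patterns {α : Type*} (s : Finset α) (r q : α → ℕ)
    (h : ∀ a ∈ s, 1 ≤ r a ∧ r a ≤ q a ∧ q a ≤ n)
    (hinj : ∀ a ∈ s, ∀ b ∈ s, r a = r b → q a = q b → a = b) :
    {S | ∃ a ∈ s, ∃ f, IsPattern (r a) (q a) f ∧ S = (sheet f : Pos n → ℤ)}.ncard =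
      ∑ a ∈ s, (n - 1) * (n - 2) ^ (r a - 1) := by
  classical
  have heq : {S | ∃ a ∈ s, ∃ f, IsPattern (r a) (q a) f ∧ S = (sheet f : Pos n → ℤ)} =
      sheet '' ((s.biUnion fun a => patterns n (r a) (q a) : Finset (Fin n → Fin n)) :
        Set (Fin n → Fin n)) := by
    ext S
    simp only [Set.mem_ofPred_eq, Set.mem_image, Finset.mem_coe, Finset.mem_biUnion]
    constructor
    · rintro ⟨a, ha, f, hf, rfl⟩
      exact ⟨f, ⟨a, ha, hf.mem⟩, rfl⟩
    · rintro ⟨f, ⟨a, ha, hf⟩, rfl⟩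
      exact ⟨a, ha, f, ⟨(h a ha).1, (h a ha).2.1, (h a ha).2.2, hf⟩, rfl⟩
  rw [heq, Set.ncard_image_of_injective _ sheet_injective, Set.ncard_coe_finset,
    Finset.card_biUnion]
  · exact Finset.sum_congr rfl fun a ha => card_patterns (h a ha).1 (h a ha).2.1 (h a ha).2.2
  · intro a ha b hb hab
    refine Finset.disjoint_left.2 fun f hfa hfb => hab ?_
    obtain ⟨h1, h2⟩ := IsPattern.unique ⟨(h a ha).1, (h a ha).2.1, (h a ha).2.2, hfa⟩
      ⟨(h b hb).1, (h b hb).2.1, (h b hb).2.2, hfb⟩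
    exact hinj a ha b hb h1 h2

theorem ncard_setA : (setA n).ncard = (n - 1) * ∑ i ∈ Finset.range n, (n - 2) ^ i := by
  have heq : setA n = {S | ∃ i ∈ Finset.range n, ∃ f, IsPattern (i + 1) (i + 1) f ∧
      S = (sheet f : Pos n → ℤ)} := by
    ext S
    rw [mem_setA_iff]
    constructor
    · rintro ⟨r, f, hf, rfl⟩
      obtain ⟨i, rfl⟩ := Nat.exists_eq_add_of_le' hf.one_le
      exact ⟨i, Finset.mem_range.2 hf.le_n, f, hf, rfl⟩
    · rintro ⟨i, -, f, hf, rfl⟩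
      exact ⟨i + 1, f, hf, rfl⟩
  rw [heq, ncard_biUnion_patterns (Finset.range n) (fun i => i + 1) (fun i => i + 1)
    (fun i hi => ⟨by omega, le_rfl, Finset.mem_range.1 hi⟩) (fun a _ b _ h _ => by omega),
    Finset.mul_sum]
  simp

theorem ncard_setB :
    (setB n).ncard = (n - 1) * ∑ i ∈ Finset.range n, (n - 2) ^ i * (n - i - 1) := by
  have heq : setB n = {S | ∃ a ∈ (Finset.range n).sigma fun i => Finset.range (n - i - 1),
      ∃ f, IsPattern (a.1 + 1) (a.1 + a.2 + 2) f ∧ S = (sheet f : Pos n → ℤ)} := by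
    ext S
    rw [mem_setB_iff]
    constructor
    · rintro ⟨r, q, f, hrq, hf, rfl⟩
      obtain ⟨i, rfl⟩ := Nat.exists_eq_add_of_le' hf.one_le
      obtain ⟨k, rfl⟩ := Nat.exists_eq_add_of_le (show i + 2 ≤ q by omega)
      have := hf.le_n
      refine ⟨⟨i, k⟩, ?_, f, ?_, rfl⟩
      · simp only [Finset.mem_sigma, Finset.mem_range]
        omega
      · rwa [show i + k + 2 = i + 2 + k by omega]
    · rintro ⟨⟨i, k⟩, -, f, hf, rfl⟩
      exact ⟨i + 1, i + k + 2, f, by omega, hf, rfl⟩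
  rw [heq, ncard_biUnion_patterns _ (fun a : Σ _ : ℕ, ℕ => a.1 + 1) (fun a => a.1 + a.2 + 2),
    Finset.sum_sigma, Finset.mul_sum]
  · refine Finset.sum_congr rfl fun i _ => ?_
    simp only [add_tsub_cancel_right, Finset.sum_const, Finset.card_range, smul_eq_mul]
    ring
  · rintro ⟨i, k⟩ h
    simp only [Finset.mem_sigma, Finset.mem_range] at h ⊢
    omega
  · rintro ⟨i, k⟩ _ ⟨i', k'⟩ _ h1 h2
    simp only at h1 h2
    obtain rfl : i = i' := by omega
    obtain rfl : k = k' := by omega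
    rfl

theorem ncard_setA_union_setB :
    (setA n ∪ setB n).ncard = (n - 1) * ∑ i ∈ Finset.range n, (n - 2) ^ i * (n - i) := by
  have hfin : (setA n ∪ setB n).Finite := setA_union_setB ▸ finite_patternSheets
  rw [Set.ncard_union_eq ?_ (hfin.subset Set.subset_union_left)
    (hfin.subset Set.subset_union_right), ncard_setA, ncard_setB, ← mul_add,
    ← Finset.sum_add_distrib]
  · congr 1
    refine Finset.sum_congr rfl fun i hi => ?_
    have := Finset.mem_range.1 hi
    rw [show n - i = n - i - 1 + 1 by omega]
    simp only [add_tsub_cancel_right]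
    ring
  · refine Set.disjoint_left.2 fun S hA hB => ?_
    obtain ⟨r, f, hf, rfl⟩ := mem_setA_iff.1 hA
    obtain ⟨r', q', g, hrq, hg, h⟩ := mem_setB_iff.1 hB
    obtain rfl := sheet_injective h
    obtain ⟨h1, h2⟩ := hf.unique hg
    omega

theorem sum_pow_mul_sub_eq (m n : ℕ) : ∑ i ∈ Finset.range n, m ^ i * (n - i) =
    ∑ k ∈ Finset.range n, ∑ i ∈ Finset.range (k + 1), m ^ i := by
  induction n with
  | zero => simp
  | succ n ih =>
    rw [Finset.sum_range_succ (fun k => ∑ i ∈ Finset.range (k + 1), m ^ i), ← ih,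
      Finset.sum_range_succ, Finset.sum_range_succ (fun i => m ^ i), ← add_assoc,
      ← Finset.sum_add_distrib]
    congr 1
    · refine Finset.sum_congr rfl fun i hi => ?_
      rw [Nat.sub_add_comm (Finset.mem_range.1 hi).le]
      ring
    · simp

end Card

theorem mainTheorem1 (n : ℕ) (hn : 3 ≤ n) :
    -- the Hilbert basis is `A_n ∪ B_n`, which is the least system of generators
    hilbertBasis (runnerUpConsistent n) = setA n ∪ setB n ∧
    IsLeast {G : Set (Pos n → ℤ) | AddSubmonoid.closure G = runnerUpConsistent n}
      (setA n ∪ setB n) ∧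
    (∀ S ∈ setA n ∪ setB n, ∀ p, S p = 0 ∨ S p = 1) ∧
    -- extreme integral generators
    hilbertBasis (runnerUpConsistent n) =
      extremeIntegralGenerators (coneOf (runnerUpConsistent n)) ∧
    -- the polytope spanned by the Hilbert basis, its vertices, compressedness
    convexHull ℝ (latticeEmb '' hilbertBasis (runnerUpConsistent n)) =
      {x ∈ coneOf (runnerUpConsistent n) | degOne x = 1} ∧
    (convexHull ℝ (latticeEmb '' hilbertBasis (runnerUpConsistent n))).extremePoints ℝ =
      latticeEmb '' hilbertBasis (runnerUpConsistent n) ∧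
    IsCompressed (convexHull ℝ (latticeEmb '' hilbertBasis (runnerUpConsistent n))) ∧
    -- cardinalities
    (setA n).ncard = (n - 1) * ∑ i ∈ Finset.range n, (n - 2) ^ i ∧
    (setB n).ncard = (n - 1) * ∑ i ∈ Finset.range n, (n - 2) ^ i * (n - i - 1) ∧
    (setA n ∪ setB n).ncard = (n - 1) * ∑ i ∈ Finset.range n, (n - 2) ^ i * (n - i) ∧
    (hilbertBasis (runnerUpConsistent n)).ncard =
      (n - 1) * ∑ i ∈ Finset.range n, (n - 2) ^ i * (n - i) ∧
    (hilbertBasis (runnerUpConsistent n)).ncard =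
      (n - 1) * ∑ k ∈ Finset.range n, ∑ i ∈ Finset.range (k + 1), (n - 2) ^ i := by
  have hcard := ncard_setA_union_setB (n := n)
  rw [setA_union_setB] at hcard ⊢
  rw [hilbertBasis_eq]
  refine ⟨rfl, ⟨closure_patternSheets, fun G hG => ?_⟩, ?_, extremeIntegralGenerators_eq.symm,
    convexHull_patternSheets.trans faceOf_eq_coneOf_inter, extremePoints_convexHull_patternSheets,
    isCompressed_convexHull_patternSheets, ncard_setA, ncard_setB, hcard, hcard,
    hcard.trans (by rw [sum_pow_mul_sub_eq])⟩
  · rw [← hilbertBasis_eq]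
    exact hilbertBasis_subset_of_closure_eq (fun _ => eq_zero_of_isAddUnit) hG
  · rintro _ ⟨r, q, f, hf, rfl⟩ p
    exact hf.slack_eq (.inl p)
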